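/- Let $k\ge 1$ and let $\mathcal P_2(\mathbb R^k)$ be the set of Borel probability measures on $\mathbb R^k$ with finite second moment. On $\mathcal P_2$ (over $\mathbb R^k$ or $\mathbb R$) put $W_2(\mu,\nu)^2=\inf_{\pi}\int\frac12|x-y|^2\,\pi(dx,dy)$, the infimum being over all couplings $\pi$ of $\mu$ and $\nu$. For $\theta\in\mathcal S^{k-1}$ let $\mu_\theta$ be the image of $\mu$ under $x\mapsto\theta^\top x$, let $d\theta$ be the uniform probability measure on $\mathcal S^{k-1}$, and set $SW_2(\mu,\nu)^2=\int_{\mathcal S^{k-1}}W_2(\mu_\theta,\nu_\theta)^2\,d\theta$. For $\sigma>0$ let $\mathcal N_\sigma$ be the normal distribution on $\mathbb R^k$ with mean $0$ and covariance $\sigma^2I_k$, $\mu^\sigma=\mu*\mathcal N_\sigma$, $SW_2^\sigma(\mu,\nu)=SW_2(\mu^\sigma,\nu^\sigma)$, and $T_\theta^\sigma=F_{\nu^\sigma_\theta}^{-1}\circ F_{\mu^\sigma_\theta}$, where $F_\rho$ is the cumulative distribution function of $\rho$ and $\mu^\sigma_\theta=(\mu^\sigma)_\theta$. The $L$-derivative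 of $u:\mathcal P_2(\mathbb R^k)\to\mathbb R$ is the function $D_\mu u:\mathcal P_2(\mathbb R^k)\times\mathbb R^k\to\mathbb R^k$, jointly continuous for $W_2$ and the Euclidean distance, such that on every atomless probability space the lift $X\mapsto u(\mathbb P_X)$ is Fréchet differentiable at every $X\in L^2(\Omega;\mathbb R^k)$ with gradient $D_\mu u(\mathbb P_X)(X)$. We write $D^2_{x\mu}u(\mu)(x)$ for the derivative (Jacobian) of $x\mapsto D_\mu u(\mu)(x)$, and $|\cdot|$ for the operator norm of a matrix. There is a constant $C>0$, depending only on $k$, such that for all $\sigma>0$ and $\nu\in\mathcal P_2(\mathbb R^k)$ the function $\mu\mapsto SW_2^\sigma(\mu,\nu)^2$ has an $L$-derivative, and for every $\mu\in\mathcal P_2(\mathbb R^k)$: the maps $T^\sigma_\theta$ are differentiable; the $L$-derivative at $\mu$ is differentiable in $x$ at every $x\in\mathbb R^k$, with $$D^2_{x\mu}SW_2^\sigma(\mu,\nu)^2(x)=\mathbb E\int_{\mathcal S^{k-1}}\theta\theta^\top\bigl(1-(T^\sigma_\theta)'(\theta^\top(x+N_\sigma))\bigr)\,d\theta,\qquad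 N_\sigma\sim\mathcal N_\sigma,$$ where the integrand is integrable jointly in $(N_\sigma,\theta)$; and $$\int_{\mathbb R^k}\bigl|D^2_{x\mu}SW_2^\sigma(\mu,\nu)^2(x)\bigr|\,\mu(dx)\le C\Bigl(1+\frac1\sigma\Bigl(\int_{\mathbb R^k}|y|^2\,\nu^\sigma(dy)\Bigr)^{1/2}\Bigr).$$ -/

import Mathlib

open MeasureTheory ProbabilityTheory

namespace SlicedW

/-- The Euclidean space `ℝᵏ`. -/
abbrev Euc (k : ℕ) : Type := EuclideanSpace ℝ (Fin k)

/-- The unit sphere of `ℝᵏ`. -/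
abbrev Sph (k : ℕ) : Type := Metric.sphere (0 : Euc k) 1

/-- Borel probability measures on `ℝᵏ` with finite second moment. -/
def P2 (k : ℕ) : Type :=
  {μ : Measure (Euc k) // IsProbabilityMeasure μ ∧ MemLp id 2 μ}

/-- Probability measures on the product with marginals `μ` and `ν`. -/
def couplings {F : Type*} [MeasurableSpace F] (μ ν : Measure F) : Set (Measure (F × F)) :=
  {π | IsProbabilityMeasure π ∧ π.map Prod.fst = μ ∧ π.map Prod.snd = ν}

/-- The squared Wasserstein distance, for the cost `|x - y|² / 2`. -/
noncomputable def W2sq {F : Type*} [NormedAddCommGroup F] [MeasurableSpace F]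
    (μ ν : Measure F) : ℝ :=
  (⨅ π ∈ couplings μ ν, ∫⁻ p, ENNReal.ofReal (‖p.1 - p.2‖ ^ 2 / 2) ∂π).toReal

/-- The Wasserstein distance on `P2 k`. -/
noncomputable def W2 {k : ℕ} (μ ν : P2 k) : ℝ := Real.sqrt (W2sq μ.1 ν.1)

/-- The rotation-invariant probability measure on the sphere. -/
noncomputable def unif (k : ℕ) : Measure (Sph k) :=
  ((volume : Measure (Euc k)).toSphere Set.univ)⁻¹ • (volume : Measure (Euc k)).toSphere

/-- The push-forward of `μ` under `x ↦ θᵀ x`. -/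
noncomputable def slice {k : ℕ} (θ : Sph k) (μ : Measure (Euc k)) : Measure ℝ :=
  μ.map (fun x => inner ℝ (θ : Euc k) x)

/-- The squared sliced Wasserstein distance. -/
noncomputable def SW2sq {k : ℕ} (μ ν : Measure (Euc k)) : ℝ :=
  ∫ θ, W2sq (slice θ μ) (slice θ ν) ∂(unif k)

/-- The centred normal distribution on `ℝᵏ` with covariance `σ² I`. -/
noncomputable def gauss (k : ℕ) (σ : ℝ) : Measure (Euc k) :=
  multivariateGaussian 0 (σ ^ 2 • (1 : Matrix (Fin k) (Fin k) ℝ))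

/-- The convolution of `μ` with the centred normal distribution with covariance `σ² I`. -/
noncomputable def reg {k : ℕ} (σ : ℝ) (μ : Measure (Euc k)) : Measure (Euc k) :=
  μ.conv (gauss k σ)

/-- The squared Gaussian regularized sliced Wasserstein distance. -/
noncomputable def SW2regSq {k : ℕ} (σ : ℝ) (μ ν : P2 k) : ℝ :=
  SW2sq (reg σ μ.1) (reg σ ν.1)

/-- The inverse of the cumulative distribution function of `ρ`. -/
noncomputable def quantile (ρ : Measure ℝ) (p : ℝ) : ℝ := sInf {y | p ≤ cdf ρ y}

/-- The monotone transport map between the slices in direction `θ` of the regularizations of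
`μ` and `ν`. -/
noncomputable def transportMap {k : ℕ} (σ : ℝ) (μ ν : P2 k) (θ : Sph k) (t : ℝ) : ℝ :=
  quantile (slice θ (reg σ ν.1)) (cdf (slice θ (reg σ μ.1)) t)

/-- Every event of positive probability contains one of strictly smaller positive probability.
(`NoAtoms` only says that points are null.) -/
def IsAtomless {Ω : Type*} [MeasurableSpace Ω] (P : Measure Ω) : Prop :=
  ∀ A, MeasurableSet A → 0 < P A → ∃ B, MeasurableSet B ∧ B ⊆ A ∧ 0 < P B ∧ P B < P A

/-- The law of a square-integrable random vector. -/
noncomputable def law {k : ℕ} {Ω : Type*} [MeasurableSpace Ω] (P : Measure Ω)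
    [IsProbabilityMeasure P] (X : Lp (Euc k) 2 P) : P2 k :=
  ⟨P.map X, Measure.isProbabilityMeasure_map (Lp.aestronglyMeasurable X).aemeasurable,
    (memLp_map_measure_iff aestronglyMeasurable_id
      (Lp.aestronglyMeasurable X).aemeasurable).2 (Lp.memLp X)⟩

/-- Joint continuity on `P2 k × ℝᵏ`, with the Wasserstein distance on the first factor. -/
def JointlyContinuous {k : ℕ} (D : P2 k → Euc k → Euc k) : Prop :=
  ∀ μ x, ∀ ε > 0, ∃ δ > 0, ∀ μ' x', W2 μ' μ < δ → ‖x' - x‖ < δ → ‖D μ' x' - D μ x‖ < ε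

/-- `D` is the `L`-derivative of `u`: it is jointly continuous, and at every `X` in `L²(Ω; ℝᵏ)`
the lift `X ↦ u (law X)` is Fréchet differentiable with gradient `D (law X) (X)`. -/
def IsLDerivative {k : ℕ} {Ω : Type*} [MeasurableSpace Ω] (P : Measure Ω)
    [IsProbabilityMeasure P] (u : P2 k → ℝ) (D : P2 k → Euc k → Euc k) : Prop :=
  JointlyContinuous D ∧
    ∀ X : Lp (Euc k) 2 P, ∃ h : MemLp (fun ω => D (law P X) (X ω)) 2 P,
      HasGradientAt (fun Y : Lp (Euc k) 2 P => u (law P Y)) (h.toLp _) X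

/-- `θ θᵀ (1 - T'(θᵀ (x + z)))`, as a linear map on `ℝᵏ`. -/
noncomputable def hessIntegrand {k : ℕ} (σ : ℝ) (μ ν : P2 k) (x z : Euc k) (θ : Sph k) :
    Euc k →L[ℝ] Euc k :=
  (1 - deriv (transportMap σ μ ν θ) (inner ℝ (θ : Euc k) (x + z))) •
    InnerProductSpace.rankOne ℝ (θ : Euc k) (θ : Euc k)

end SlicedW

open SlicedW

namespace SlicedW

open Set Filter Topology
open scoped NNReal RealInnerProductSpace

/-! ### Monotone transport on the line -/

/-! Slicing commutes with Gaussian convolution, so every slice of a regularized measure is a law on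
the line convolved with a Gaussian of variance `v = σ²`. Its distribution function has a positive
derivative everywhere; hence `T_θ` is a differentiable increasing bijection of the line, and it is
optimal for the quadratic cost by one-dimensional duality (`RegularCDF.W2sq_eq`).

Differentiability in the measure comes from a two-sided comparison. Realize the noise `N` on a
second factor and the direction on a third. The lift is then `‖A Y‖² / 2`, where `A Y = θᵀ(Y + N) -
T_θ(θᵀ(Y + N))` lives in `L²(Ω × ℝᵏ × sphere)`. Keeping the target sample `T_θ(θᵀ(X + N))` of
another vector `X` still gives a coupling with the slice of the regularization of `ν`, so the lift
at `Y` is at most `‖A X + S (Y - X)‖² / 2` with `S H = θᵀ H`. Using this inequality in both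
directions, `hasGradientAt_of_half_norm_sq` needs only continuity of `A` to get the gradient `S* (A
X)`, which is `gradField` evaluated at `X`. Continuity of `A` holds because `T_θ` depends
continuously on measure, direction and point, while `T_θ(θᵀ(Y + N))` has an `L²` norm independent of
`Y` (`tendsto_integral_sq_sub`).

For the regularity in `x`, `gradField` is written through the density of `θᵀ(x + N)`, so that `x`
enters only through the Gaussian. The maps satisfy `|T_θ t| ≤ K exp (t² / 3v)` (`abs_monoMap_le`).
As `1/3 < 1/2`, this is integrable against the density, uniformly in `θ` and locally uniformly in
`μ` and `x`, and one may differentiate under the integral. Gaussian integration by parts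
(`integrable_deriv_mul_gaussianPDFReal`) moves the derivative onto `T_θ` and gives the Hessian
formula.

The bound uses the same identity: the mean of `T_θ'` is `𝔼[T_θ(θᵀ(X + N)) θᵀN] / σ²`, and
Cauchy-Schwarz bounds it by `1/σ` times the root of the second moment of the regularized `ν`. -/

/-- The cumulative distribution function of `ρ` has a positive derivative at every point. -/
def RegularCDF (ρ : Measure ℝ) : Prop := ∀ t, ∃ d, 0 < d ∧ HasDerivAt (cdf ρ) d t

/-- The monotone rearrangement of `ρ` onto `η`. -/
noncomputable def monoMap (ρ η : Measure ℝ) (t : ℝ) : ℝ := quantile η (cdf ρ t)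

namespace RegularCDF

variable {ρ η : Measure ℝ}

lemma differentiable (h : RegularCDF ρ) : Differentiable ℝ (cdf ρ) := fun t =>
  let ⟨_, _, hd⟩ := h t; hd.differentiableAt

lemma continuous (h : RegularCDF ρ) : Continuous (cdf ρ) := h.differentiable.continuous

lemma strictMono (h : RegularCDF ρ) : StrictMono (cdf ρ) :=
  strictMono_of_deriv_pos fun t => let ⟨_, h0, hd⟩ := h t; hd.deriv ▸ h0

lemma cdf_mem_Ioo (h : RegularCDF ρ) (t : ℝ) : cdf ρ t ∈ Ioo (0 : ℝ) 1 :=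
  ⟨(cdf_nonneg ρ (t - 1)).trans_lt (h.strictMono (by linarith)),
    (h.strictMono (show t < t + 1 by linarith)).trans_le (cdf_le_one ρ _)⟩

lemma exists_cdf_eq (h : RegularCDF ρ) {p : ℝ} (hp : p ∈ Ioo (0 : ℝ) 1) : ∃ t, cdf ρ t = p := by
  obtain ⟨a, ha⟩ := ((tendsto_cdf_atBot ρ).eventually (gt_mem_nhds hp.1)).exists
  obtain ⟨b, hb⟩ := ((tendsto_cdf_atTop ρ).eventually (lt_mem_nhds hp.2)).exists
  exact mem_range_of_exists_le_of_exists_ge h.continuous ⟨a, ha.le⟩ ⟨b, hb.le⟩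

lemma quantile_cdf (h : RegularCDF ρ) (t : ℝ) : quantile ρ (cdf ρ t) = t := by
  have : {y | cdf ρ t ≤ cdf ρ y} = Ici t := by ext y; exact h.strictMono.le_iff_le
  rw [quantile, this, csInf_Ici]

lemma cdf_quantile (h : RegularCDF ρ) {p : ℝ} (hp : p ∈ Ioo (0 : ℝ) 1) :
    cdf ρ (quantile ρ p) = p := by
  obtain ⟨t, rfl⟩ := h.exists_cdf_eq hp
  rw [h.quantile_cdf]

lemma cdf_monoMap (hρ : RegularCDF ρ) (hη : RegularCDF η) (t : ℝ) :
    cdf η (monoMap ρ η t) = cdf ρ t :=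
  hη.cdf_quantile (hρ.cdf_mem_Ioo t)

lemma monoMap_monoMap (hρ : RegularCDF ρ) (hη : RegularCDF η) (t : ℝ) :
    monoMap η ρ (monoMap ρ η t) = t := by
  rw [monoMap, hρ.cdf_monoMap hη, hρ.quantile_cdf]

lemma strictMono_monoMap (hρ : RegularCDF ρ) (hη : RegularCDF η) :
    StrictMono (monoMap ρ η) := fun s t hst => by
  rw [← hη.strictMono.lt_iff_lt, hρ.cdf_monoMap hη, hρ.cdf_monoMap hη]
  exact hρ.strictMono hst

lemma monoMap_le_iff (hρ : RegularCDF ρ) (hη : RegularCDF η) (t y : ℝ) :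
    monoMap ρ η t ≤ y ↔ t ≤ monoMap η ρ y := by
  rw [← (hη.strictMono_monoMap hρ).le_iff_le, hρ.monoMap_monoMap hη]

lemma continuous_monoMap (hρ : RegularCDF ρ) (hη : RegularCDF η) :
    Continuous (monoMap ρ η) :=
  (hρ.strictMono_monoMap hη).monotone.continuous_of_surjective
    fun y => ⟨_, hη.monoMap_monoMap hρ y⟩

lemma differentiable_monoMap (hρ : RegularCDF ρ) (hη : RegularCDF η) :
    Differentiable ℝ (monoMap ρ η) := fun t => by
  obtain ⟨a, ha, hda⟩ := hη (monoMap ρ η t)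
  obtain ⟨b, hb, hdb⟩ := hρ (monoMap η ρ (monoMap ρ η t))
  -- Inverse function rule on `(0, 1)`, the only place where the quantile inverts the distribution
  -- function. Continuity of the quantile there is automatic: it is monotone on `(0, 1)` with image
  -- the whole line.
  have hq : HasDerivAt (quantile η) a⁻¹ (cdf ρ t) := by
    have hm := hρ.cdf_mem_Ioo t
    refine HasDerivAt.of_local_left_inverse (f := cdf η) ?_ (by exact hda) ha.ne' ?_
    · refine continuousAt_of_monotoneOn_of_image_mem_nhds (s := Ioo 0 1) ?_
        (Ioo_mem_nhds hm.1 hm.2) ?_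
      · intro p hp q hq hpq
        rwa [← hη.strictMono.le_iff_le, hη.cdf_quantile hp, hη.cdf_quantile hq]
      · convert univ_mem
        exact eq_univ_of_forall fun y => ⟨cdf η y, hη.cdf_mem_Ioo y, hη.quantile_cdf y⟩
    · filter_upwards [Ioo_mem_nhds hm.1 hm.2] with p hp using hη.cdf_quantile hp
  obtain ⟨c, hc, hdc⟩ := hρ t
  exact (hq.comp t hdc).differentiableAt

lemma map_monoMap [IsProbabilityMeasure ρ] [IsProbabilityMeasure η]
    (hρ : RegularCDF ρ) (hη : RegularCDF η) : ρ.map (monoMap ρ η) = η := by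
  have hm := (hρ.continuous_monoMap hη).measurable
  have := Measure.isProbabilityMeasure_map (μ := ρ) hm.aemeasurable
  refine Measure.eq_of_cdf _ _ ?_
  ext y
  rw [cdf_eq_real, measureReal_def, Measure.map_apply hm measurableSet_Iic]
  have : monoMap ρ η ⁻¹' Iic y = Iic (monoMap η ρ y) := by
    ext t; exact hρ.monoMap_le_iff hη t y
  rw [this, ← measureReal_def, ← cdf_eq_real, hη.cdf_monoMap hρ]

/-- Stability of the solution of `cdf η y = p`. -/
lemma tendsto_of_tendsto_cdf {ι : Type*} {l : Filter ι} {ηs : ι → Measure ℝ}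
    (hηs : ∀ i, RegularCDF (ηs i)) (hη : RegularCDF η) {ys : ι → ℝ} {y : ℝ}
    (hcdf : ∀ x, Tendsto (fun i => cdf (ηs i) x) l (𝓝 (cdf η x)))
    (hy : Tendsto (fun i => cdf (ηs i) (ys i)) l (𝓝 (cdf η y))) : Tendsto ys l (𝓝 y) := by
  refine tendsto_order.2 ⟨fun a ha => ?_, fun a ha => ?_⟩
  · filter_upwards [(hcdf a).eventually_lt hy (hη.strictMono ha)] with i hi
    exact (hηs i).strictMono.lt_iff_lt.1 hi
  · filter_upwards [hy.eventually_lt (hcdf a) (hη.strictMono ha)] with i hi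
    exact (hηs i).strictMono.lt_iff_lt.1 hi

lemma tendsto_monoMap {ι : Type*} {l : Filter ι} {ρs ηs : ι → Measure ℝ}
    (hρs : ∀ i, RegularCDF (ρs i)) (hηs : ∀ i, RegularCDF (ηs i)) (hρ : RegularCDF ρ)
    (hη : RegularCDF η) {ts : ι → ℝ} {t : ℝ}
    (hcdfη : ∀ x, Tendsto (fun i => cdf (ηs i) x) l (𝓝 (cdf η x)))
    (hcdfρ : Tendsto (fun i => cdf (ρs i) (ts i)) l (𝓝 (cdf ρ t))) :
    Tendsto (fun i => monoMap (ρs i) (ηs i) (ts i)) l (𝓝 (monoMap ρ η t)) := by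
  refine hη.tendsto_of_tendsto_cdf hηs hcdfη ?_
  rw [hρ.cdf_monoMap hη]
  simpa only [fun i => (hρs i).cdf_monoMap (hηs i) (ts i)] using hcdfρ

/-- A Chebyshev bound for the monotone rearrangement. -/
lemma sq_monoMap_mul_le [IsProbabilityMeasure η] (hρ : RegularCDF ρ) (hη : RegularCDF η)
    (h2 : Integrable (fun y => y ^ 2) η) {c t : ℝ} (hc1 : c ≤ cdf ρ t)
    (hc2 : c ≤ 1 - cdf ρ t) : (monoMap ρ η t) ^ 2 * c ≤ ∫ y, y ^ 2 ∂η := by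
  set a := monoMap ρ η t
  have hcheb : a ^ 2 * η.real {y | a ^ 2 ≤ y ^ 2} ≤ ∫ y, y ^ 2 ∂η :=
    mul_meas_ge_le_integral_of_nonneg (ae_of_all _ fun y => sq_nonneg y) h2 _
  refine le_trans (mul_le_mul_of_nonneg_left ?_ (sq_nonneg a)) hcheb
  have hF : cdf η a = cdf ρ t := hρ.cdf_monoMap hη t
  -- The half-line beyond `a`, on the side away from `0`, lies in `{y | a² ≤ y²}`; its mass is one
  -- of the two tails bounded below by `c`.
  rcases le_total 0 a with ha | ha
  · have h1 : 1 - cdf η a = η.real (Ioi a) := by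
      rw [cdf_eq_real, ← compl_Iic, probReal_compl_eq_one_sub measurableSet_Iic]
    rw [← hF, h1] at hc2
    refine hc2.trans (measureReal_mono fun y (hy : a < y) => ?_)
    exact pow_le_pow_left₀ ha hy.le 2
  · rw [← hF, cdf_eq_real] at hc1
    refine hc1.trans (measureReal_mono fun y (hy : y ≤ a) => ?_)
    show a ^ 2 ≤ y ^ 2
    nlinarith

end RegularCDF

/-! ### Quadratic transport cost -/

lemma W2sq_le_integral {F : Type*} [NormedAddCommGroup F] [MeasurableSpace F] {μ ν : Measure F}
    {π : Measure (F × F)} (hπ : π ∈ couplings μ ν)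
    (hi : Integrable (fun p => ‖p.1 - p.2‖ ^ 2 / 2) π) :
    W2sq μ ν ≤ ∫ p, ‖p.1 - p.2‖ ^ 2 / 2 ∂π := by
  rw [W2sq, ← ENNReal.toReal_ofReal (integral_nonneg fun p => by positivity :
    0 ≤ ∫ p, ‖p.1 - p.2‖ ^ 2 / 2 ∂π),
    ofReal_integral_eq_lintegral_ofReal hi (ae_of_all _ fun p => by positivity)]
  refine ENNReal.toReal_mono ?_ (iInf₂_le π hπ)
  rw [← ofReal_integral_eq_lintegral_ofReal hi (ae_of_all _ fun p => by positivity)]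
  exact ENNReal.ofReal_ne_top

/-- The joint law of `(U, V)` is an admissible coupling. All upper bounds on transport costs below
come from this. -/
lemma W2sq_map_le {F Ω : Type*} [NormedAddCommGroup F] [MeasurableSpace F] [BorelSpace F]
    [SecondCountableTopology F] [MeasurableSpace Ω] {P : Measure Ω} [IsProbabilityMeasure P]
    {U V : Ω → F} (hU : MemLp U 2 P) (hV : MemLp V 2 P) :
    W2sq (P.map U) (P.map V) ≤ ∫ ω, ‖U ω - V ω‖ ^ 2 / 2 ∂P := by
  have hUm := hU.aestronglyMeasurable.aemeasurable
  have hVm := hV.aestronglyMeasurable.aemeasurable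
  have hm : AEMeasurable (fun ω => (U ω, V ω)) P := hUm.prodMk hVm
  have hc : Continuous fun p : F × F => ‖p.1 - p.2‖ ^ 2 / 2 := by fun_prop
  have hi : Integrable (fun ω => ‖U ω - V ω‖ ^ 2 / 2) P :=
    ((hU.sub hV).integrable_norm_pow two_ne_zero).div_const 2
  have := W2sq_le_integral (μ := P.map U) (ν := P.map V) (π := P.map fun ω => (U ω, V ω))
    ⟨Measure.isProbabilityMeasure_map hm, by
      rw [AEMeasurable.map_map_of_aemeasurable measurable_fst.aemeasurable hm]; rfl, by
      rw [AEMeasurable.map_map_of_aemeasurable measurable_snd.aemeasurable hm]; rfl⟩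
    ((integrable_map_measure hc.aestronglyMeasurable hm).2 hi)
  rwa [integral_map hm hc.aestronglyMeasurable] at this

section Couplings

variable {F : Type*} [NormedAddCommGroup F] [MeasurableSpace F] [BorelSpace F]
  [SecondCountableTopology F] {μ ν : Measure F} {π : Measure (F × F)}

lemma memLp_sub_of_mem_couplings (hμ : MemLp id 2 μ) (hν : MemLp id 2 ν)
    (hπ : π ∈ couplings μ ν) : MemLp (fun p : F × F => p.1 - p.2) 2 π := by
  obtain ⟨-, h1, h2⟩ := hπ
  rw [← h1] at hμ
  rw [← h2] at hν
  exact ((memLp_map_measure_iff aestronglyMeasurable_id measurable_fst.aemeasurable).1 hμ).sub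
    ((memLp_map_measure_iff aestronglyMeasurable_id measurable_snd.aemeasurable).1 hν)

lemma lintegral_cost_eq (hμ : MemLp id 2 μ) (hν : MemLp id 2 ν) (hπ : π ∈ couplings μ ν) :
    ∫⁻ p, ENNReal.ofReal (‖p.1 - p.2‖ ^ 2 / 2) ∂π =
      ENNReal.ofReal (∫ p, ‖p.1 - p.2‖ ^ 2 / 2 ∂π) :=
  have := hπ.1
  (ofReal_integral_eq_lintegral_ofReal
    (((memLp_sub_of_mem_couplings hμ hν hπ).integrable_norm_pow two_ne_zero).div_const 2)
      (ae_of_all _ fun p => by positivity)).symm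

/-- The product coupling has finite cost. Since `W2sq` takes `toReal`, which sends `⊤` to `0`, lower
bounds on it require this finiteness. -/
lemma iInf_cost_ne_top [IsProbabilityMeasure μ] [IsProbabilityMeasure ν] (hμ : MemLp id 2 μ)
    (hν : MemLp id 2 ν) :
    (⨅ π ∈ couplings μ ν, ∫⁻ p, ENNReal.ofReal (‖p.1 - p.2‖ ^ 2 / 2) ∂π) ≠ ⊤ := by
  have hprod : μ.prod ν ∈ couplings μ ν := ⟨inferInstance, by simp, by simp⟩
  exact ne_top_of_le_ne_top
    (by rw [lintegral_cost_eq hμ hν hprod]; exact ENNReal.ofReal_ne_top) (iInf₂_le _ hprod)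

end Couplings

/-- Subgradient inequality for the convex primitive of `T`. -/
lemma mul_sub_le_integral_of_monotone {T : ℝ → ℝ} (hT : Monotone T) (s x : ℝ) :
    T s * (x - s) ≤ (∫ r in (0 : ℝ)..x, T r) - ∫ r in (0 : ℝ)..s, T r := by
  have hi : ∀ a b, IntervalIntegrable T volume a b := fun a b => hT.intervalIntegrable
  rw [intervalIntegral.integral_interval_sub_left (hi _ _) (hi _ _)]
  rcases le_total s x with h | h
  · have := intervalIntegral.integral_mono_on (μ := volume) h (by simp) (hi s x)
      (fun r hr => hT hr.1)
    simpa [mul_comm] using this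
  · have := intervalIntegral.integral_mono_on (μ := volume) h (hi x s) (by simp)
      (fun r hr => hT hr.2)
    rw [intervalIntegral.integral_symm]
    simp only [intervalIntegral.integral_const, smul_eq_mul] at this
    linarith

/-- On the line the monotone rearrangement is optimal for the quadratic cost. -/
theorem RegularCDF.W2sq_eq {ρ η : Measure ℝ} [IsProbabilityMeasure ρ] [IsProbabilityMeasure η]
    (hρ : RegularCDF ρ) (hη : RegularCDF η) (h2ρ : MemLp id 2 ρ) (h2η : MemLp id 2 η) :
    W2sq ρ η = ∫ t, (t - monoMap ρ η t) ^ 2 / 2 ∂ρ := by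
  set T := monoMap ρ η with hTdef
  set S := monoMap η ρ with hSdef
  have hT := hρ.continuous_monoMap hη
  have hS := hη.continuous_monoMap hρ
  have hmap : ρ.map T = η := hρ.map_monoMap hη
  have h2T : MemLp T 2 ρ := by
    rw [← hmap, memLp_map_measure_iff aestronglyMeasurable_id hT.measurable.aemeasurable] at h2η
    exact h2η
  refine le_antisymm ?_ ?_
  · have := W2sq_map_le h2ρ h2T
    rw [hmap, Measure.map_id] at this
    simpa using this
  -- Kantorovich duality: the primitive of `T` is the convex potential, and its subgradient
  -- inequality makes any coupling at least as costly as the monotone one.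
  set φ : ℝ → ℝ := fun x => ∫ r in (0 : ℝ)..x, T r with hφ
  have hkey : ∀ s x, T s * (x - s) ≤ φ x - φ s :=
    mul_sub_le_integral_of_monotone (hρ.strictMono_monoMap hη).monotone
  have hφc : Continuous φ :=
    intervalIntegral.continuous_primitive (fun a b => hT.intervalIntegrable a b) 0
  have hφi : Integrable φ ρ := by
    -- The subgradient inequalities between `0` and `x` give `T 0 * x ≤ φ x ≤ x * T x`.
    have h1 : Integrable (fun x => |x| * |T x| + |T 0| * |x|) ρ :=
      (MemLp.integrable_mul h2ρ.norm h2T.norm).add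
        ((h2ρ.integrable one_le_two).norm.const_mul |T 0|)
    refine h1.mono' hφc.aestronglyMeasurable (ae_of_all _ fun x => ?_)
    have ha := hkey 0 x
    have hb := hkey x 0
    have h0 : φ 0 = 0 := intervalIntegral.integral_same
    rw [h0] at ha hb
    rw [Real.norm_eq_abs, abs_le, ← abs_mul, ← abs_mul]
    constructor
    · have := neg_abs_le (T 0 * x); have := abs_nonneg (x * T x); linarith
    · have := le_abs_self (x * T x); have := abs_nonneg (T 0 * x); linarith
  -- The dual pair. The bracket in `β` is the Legendre transform of `φ`, attained at `S y`, so `α x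
  -- + β y` is at most the cost, with equality for `y = T x`.
  set α : ℝ → ℝ := fun x => x ^ 2 / 2 - φ x
  set β : ℝ → ℝ := fun y => y ^ 2 / 2 - (y * S y - φ (S y))
  have hβc : Continuous β := by fun_prop
  have hST : ∀ x, S (T x) = x := hρ.monoMap_monoMap hη
  have hTS : ∀ y, T (S y) = y := hη.monoMap_monoMap hρ
  have hαi : Integrable α ρ := (h2ρ.integrable_sq.div_const 2).sub hφi
  have hβTi : Integrable (fun x => β (T x)) ρ := by
    simp only [β, hST]
    exact (h2T.integrable_sq.div_const 2).sub ((MemLp.integrable_mul h2T h2ρ).sub hφi)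
  have hβi : Integrable β η := by
    rw [← hmap, integrable_map_measure hβc.aestronglyMeasurable hT.measurable.aemeasurable]
    exact hβTi
  have hval : ∫ t, (t - T t) ^ 2 / 2 ∂ρ = ∫ x, α x ∂ρ + ∫ y, β y ∂η := by
    rw [← hmap, integral_map hT.measurable.aemeasurable hβc.aestronglyMeasurable,
      ← integral_add hαi hβTi]
    congr 1
    ext x
    simp only [α, β, hST]
    ring
  have hpt : ∀ x y, α x + β y ≤ ‖x - y‖ ^ 2 / 2 := fun x y => by
    have := hkey (S y) x
    rw [hTS] at this
    simp only [α, β, Real.norm_eq_abs, sq_abs]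
    nlinarith
  have hcpl : ∀ π ∈ couplings ρ η, ENNReal.ofReal (∫ t, (t - T t) ^ 2 / 2 ∂ρ) ≤
      ∫⁻ p, ENNReal.ofReal (‖p.1 - p.2‖ ^ 2 / 2) ∂π := by
    rintro π ⟨hπ, h1, h2⟩
    have ha : Integrable (fun p : ℝ × ℝ => α p.1) π := by
      rw [← h1] at hαi; exact hαi.comp_measurable measurable_fst
    have hb : Integrable (fun p : ℝ × ℝ => β p.2) π := by
      rw [← h2] at hβi; exact hβi.comp_measurable measurable_snd
    have e1 : ∫ x, α x ∂ρ = ∫ p, α p.1 ∂π := by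
      rw [← h1, integral_map measurable_fst.aemeasurable (by fun_prop)]
    have e2 : ∫ y, β y ∂η = ∫ p, β p.2 ∂π := by
      rw [← h2, integral_map measurable_snd.aemeasurable (by fun_prop)]
    rw [hval, e1, e2, ← integral_add ha hb]
    -- The dual integrand may be negative; its positive part is still below the cost and can be
    -- moved into `ENNReal`.
    calc ENNReal.ofReal (∫ p, (α p.1 + β p.2) ∂π)
        ≤ ENNReal.ofReal (∫ p, max (α p.1 + β p.2) 0 ∂π) :=
          ENNReal.ofReal_le_ofReal (integral_mono (ha.add hb) (ha.add hb).pos_part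
            fun p => le_max_left _ _)
      _ = ∫⁻ p, ENNReal.ofReal (max (α p.1 + β p.2) 0) ∂π :=
          ofReal_integral_eq_lintegral_ofReal (ha.add hb).pos_part
            (ae_of_all _ fun p => le_max_right _ _)
      _ ≤ _ := lintegral_mono fun p => ENNReal.ofReal_le_ofReal
          (max_le (hpt _ _) (by positivity))
  rw [W2sq, ← ENNReal.ofReal_le_iff_le_toReal (iInf_cost_ne_top h2ρ h2η)]
  exact le_iInf₂ hcpl

/-- Couplings of almost optimal cost. -/
lemma exists_coupling_lt {F : Type*} [NormedAddCommGroup F] [MeasurableSpace F] [BorelSpace F]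
    [SecondCountableTopology F] {μ ν : Measure F} [IsProbabilityMeasure μ]
    [IsProbabilityMeasure ν] (hμ : MemLp id 2 μ) (hν : MemLp id 2 ν) {c : ℝ}
    (h : W2sq μ ν < c) : ∃ π ∈ couplings μ ν, MemLp (fun p : F × F => p.1 - p.2) 2 π ∧
      ∫ p, ‖p.1 - p.2‖ ^ 2 ∂π < 2 * c := by
  have hc : 0 < c := ENNReal.toReal_nonneg.trans_lt h
  rw [W2sq, ← ENNReal.lt_ofReal_iff_toReal_lt (iInf_cost_ne_top hμ hν)] at h
  obtain ⟨π, hπ, hlt⟩ := (by simpa only [iInf_lt_iff, exists_prop] using h :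
    ∃ π, π ∈ couplings μ ν ∧ ∫⁻ p, ENNReal.ofReal (‖p.1 - p.2‖ ^ 2 / 2) ∂π < ENNReal.ofReal c)
  refine ⟨π, hπ, memLp_sub_of_mem_couplings hμ hν hπ, ?_⟩
  rw [lintegral_cost_eq hμ hν hπ, ENNReal.ofReal_lt_ofReal_iff hc, integral_div] at hlt
  linarith

/-! ### Gaussian smoothing on the line -/

section Gaussian

variable {v : ℝ≥0}

lemma gaussianPDFReal_zero_apply (v : ℝ≥0) (t : ℝ) :
    gaussianPDFReal 0 v t = (√(2 * Real.pi * v))⁻¹ * Real.exp (-t ^ 2 / (2 * v)) := by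
  rw [gaussianPDFReal, sub_zero]

lemma continuous_gaussianPDFReal (v : ℝ≥0) : Continuous (gaussianPDFReal 0 v) := by
  rw [gaussianPDFReal_def]; fun_prop

lemma gaussianPDFReal_le (v : ℝ≥0) (t : ℝ) : gaussianPDFReal 0 v t ≤ (√(2 * Real.pi * v))⁻¹ := by
  rw [gaussianPDFReal_zero_apply]
  refine mul_le_of_le_one_right (by positivity) (Real.exp_le_one_iff.2 ?_)
  rw [neg_div]
  exact neg_nonpos.2 (by positivity)

lemma gaussianPDFReal_le_of_abs_le (v : ℝ≥0) {s t : ℝ} (h : |s| ≤ t) :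
    gaussianPDFReal 0 v t ≤ gaussianPDFReal 0 v s := by
  rw [gaussianPDFReal_zero_apply, gaussianPDFReal_zero_apply]
  have : s ^ 2 ≤ t ^ 2 := sq_le_sq' (by linarith [neg_abs_le s]) ((le_abs_self s).trans h)
  gcongr

lemma hasDerivAt_gaussianPDFReal (hv : v ≠ 0) (t : ℝ) :
    HasDerivAt (gaussianPDFReal 0 v) (-(t / v) * gaussianPDFReal 0 v t) t := by
  have hv' : (v : ℝ) ≠ 0 := by exact_mod_cast hv
  have h1 : HasDerivAt (fun t : ℝ => -t ^ 2 / (2 * v)) (-(t / v)) t := by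
    refine ((hasDerivAt_pow 2 t).neg.div_const (2 * (v : ℝ))).congr_deriv ?_
    field_simp
    norm_num
  have h2 := (h1.exp.const_mul (√(2 * Real.pi * v))⁻¹)
  have : gaussianPDFReal 0 v = fun t => (√(2 * Real.pi * v))⁻¹ * Real.exp (-t ^ 2 / (2 * v)) :=
    funext (gaussianPDFReal_zero_apply v)
  rw [this]
  simpa only [mul_comm, mul_left_comm, mul_assoc] using h2

lemma hasDerivAt_cdf_gaussianReal (hv : v ≠ 0) (t : ℝ) :
    HasDerivAt (cdf (gaussianReal 0 v)) (gaussianPDFReal 0 v t) t := by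
  have hI : ∀ t, cdf (gaussianReal 0 v) t = ∫ x in Iic t, gaussianPDFReal 0 v x := fun t => by
    rw [cdf_eq_real, measureReal_def, gaussianReal_apply_eq_integral 0 hv,
      ENNReal.toReal_ofReal (integral_nonneg fun x => gaussianPDFReal_nonneg 0 v x)]
  have hi := integrable_gaussianPDFReal 0 v
  have heq : (cdf (gaussianReal 0 v) : ℝ → ℝ) =
      fun t => (∫ x in (0 : ℝ)..t, gaussianPDFReal 0 v x) + cdf (gaussianReal 0 v) 0 := by
    ext t
    rw [hI t, hI 0, ← intervalIntegral.integral_Iic_sub_Iic hi.integrableOn hi.integrableOn]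
    ring
  rw [heq]
  have hc := continuous_gaussianPDFReal v
  exact (intervalIntegral.integral_hasDerivAt_right (hc.intervalIntegrable _ _)
    (hc.stronglyMeasurableAtFilter _ _) hc.continuousAt).add_const _

lemma abs_cdf_gaussianReal_sub_le (hv : v ≠ 0) (a b : ℝ) :
    |cdf (gaussianReal 0 v) a - cdf (gaussianReal 0 v) b| ≤
      (√(2 * Real.pi * v))⁻¹ * |a - b| := by
  refine Convex.norm_image_sub_le_of_norm_hasDerivWithin_le (s := univ)
    (fun x _ => (hasDerivAt_cdf_gaussianReal hv x).hasDerivWithinAt) (fun x _ => ?_)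
    convex_univ (mem_univ b) (mem_univ a)
  rw [Real.norm_eq_abs, abs_of_nonneg (gaussianPDFReal_nonneg 0 v x)]
  exact gaussianPDFReal_le v x

/-- Each tail contains the mass of a unit interval next to `x`, which by the mean value theorem is
the density at a point of modulus at most `a + 1`. -/
lemma gaussianPDFReal_le_cdf (hv : v ≠ 0) {a x : ℝ} (h : |x| ≤ a) :
    gaussianPDFReal 0 v (a + 1) ≤ cdf (gaussianReal 0 v) x ∧
      gaussianPDFReal 0 v (a + 1) ≤ 1 - cdf (gaussianReal 0 v) x := by
  have key : ∀ y, ∃ ξ ∈ Ioo y (y + 1), gaussianPDFReal 0 v ξ =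
      cdf (gaussianReal 0 v) (y + 1) - cdf (gaussianReal 0 v) y := fun y => by
    obtain ⟨ξ, hξ, h⟩ := exists_hasDerivAt_eq_slope (cdf (gaussianReal 0 v))
      (gaussianPDFReal 0 v) (show y < y + 1 by linarith)
      (fun x _ => (hasDerivAt_cdf_gaussianReal hv x).continuousAt.continuousWithinAt)
      (fun x _ => hasDerivAt_cdf_gaussianReal hv x)
    exact ⟨ξ, hξ, by simpa using h⟩
  have hx := abs_le.1 h
  constructor
  · obtain ⟨ξ, hξ, h⟩ := key (x - 1)
    rw [sub_add_cancel] at h hξ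
    have h0 := cdf_nonneg (gaussianReal 0 v) (x - 1)
    have := gaussianPDFReal_le_of_abs_le v
      (show |ξ| ≤ a + 1 from abs_le.2 ⟨by linarith [hξ.1], by linarith [hξ.2]⟩)
    linarith
  · obtain ⟨ξ, hξ, h⟩ := key x
    have h0 := cdf_le_one (gaussianReal 0 v) (x + 1)
    have := gaussianPDFReal_le_of_abs_le v
      (show |ξ| ≤ a + 1 from abs_le.2 ⟨by linarith [hξ.1], by linarith [hξ.2]⟩)
    linarith

variable {m : Measure ℝ} [IsProbabilityMeasure m]

lemma integrable_cdf_sub (hv : v ≠ 0) (t : ℝ) :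
    Integrable (fun y => cdf (gaussianReal 0 v) (t - y)) m := by
  have hc : Continuous (cdf (gaussianReal 0 v)) :=
    continuous_iff_continuousAt.2 fun x => (hasDerivAt_cdf_gaussianReal hv x).continuousAt
  refine Integrable.of_bound (C := 1) (by fun_prop) (ae_of_all _ fun y => ?_)
  rw [Real.norm_eq_abs, abs_of_nonneg (cdf_nonneg _ _)]
  exact cdf_le_one _ _

lemma cdf_conv_gaussianReal (hv : v ≠ 0) (t : ℝ) :
    cdf (m.conv (gaussianReal 0 v)) t = ∫ y, cdf (gaussianReal 0 v) (t - y) ∂m := by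
  rw [cdf_eq_real, measureReal_def, Measure.conv,
    Measure.map_apply (by fun_prop) measurableSet_Iic,
    Measure.prod_apply ((by fun_prop : Measurable fun x : ℝ × ℝ => x.1 + x.2) measurableSet_Iic),
    integral_eq_lintegral_of_nonneg_ae (ae_of_all _ fun y => cdf_nonneg _ _)
      (integrable_cdf_sub hv t).aestronglyMeasurable]
  congr 1
  refine lintegral_congr fun y => ?_
  rw [ofReal_cdf]
  congr 1
  ext z
  simp [le_sub_iff_add_le']

/-- The derivative is the average of translated Gaussian densities: positive because they are, and
obtained under the integral because they are uniformly bounded. -/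
lemma regularCDF_conv_gaussianReal (hv : v ≠ 0) : RegularCDF (m.conv (gaussianReal 0 v)) := by
  intro t
  have hc := continuous_gaussianPDFReal v
  have hint : ∀ x, Integrable (fun y => gaussianPDFReal 0 v (x - y)) m := fun x =>
    Integrable.of_bound (C := (√(2 * Real.pi * v))⁻¹) (by fun_prop) (ae_of_all _ fun y => by
      rw [Real.norm_eq_abs, abs_of_nonneg (gaussianPDFReal_nonneg _ _ _)]
      exact gaussianPDFReal_le v _)
  refine ⟨∫ y, gaussianPDFReal 0 v (t - y) ∂m, ?_, ?_⟩
  · rw [integral_pos_iff_support_of_nonneg (fun y => gaussianPDFReal_nonneg _ _ _) (hint t)]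
    have : Function.support (fun y => gaussianPDFReal 0 v (t - y)) = univ :=
      eq_univ_of_forall fun y => (gaussianPDFReal_pos 0 v _ hv).ne'
    rw [this, measure_univ]
    exact one_pos
  · have heq : (cdf (m.conv (gaussianReal 0 v)) : ℝ → ℝ) =
        fun t => ∫ y, cdf (gaussianReal 0 v) (t - y) ∂m := funext fun t => cdf_conv_gaussianReal hv t
    rw [heq]
    refine (hasDerivAt_integral_of_dominated_loc_of_deriv_le (s := univ)
      (F' := fun x y => gaussianPDFReal 0 v (x - y)) (bound := fun _ => (√(2 * Real.pi * v))⁻¹) univ_mem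
      (Eventually.of_forall fun x => (integrable_cdf_sub hv x).aestronglyMeasurable)
      (integrable_cdf_sub hv t) (hint t).aestronglyMeasurable (ae_of_all _ fun y x _ => ?_)
      (integrable_const _) (ae_of_all _ fun y x _ => ?_)).2
    · rw [Real.norm_eq_abs, abs_of_nonneg (gaussianPDFReal_nonneg _ _ _)]
      exact gaussianPDFReal_le v _
    · simpa [Function.comp_def] using
        (hasDerivAt_cdf_gaussianReal hv (x - y)).comp x ((hasDerivAt_id x).sub_const y)

/-- Gaussian lower bounds for the two tails of a smoothed measure. -/
lemma le_cdf_conv_gaussianReal (hv : v ≠ 0) (h2 : Integrable (fun y => y ^ 2) m) {R : ℝ}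
    (hR : 0 < R) (hM : 2 * ∫ y, y ^ 2 ∂m ≤ R ^ 2) (t : ℝ) :
    gaussianPDFReal 0 v (|t| + R + 1) / 2 ≤ cdf (m.conv (gaussianReal 0 v)) t ∧
      gaussianPDFReal 0 v (|t| + R + 1) / 2 ≤ 1 - cdf (m.conv (gaussianReal 0 v)) t := by
  set A : Set ℝ := {y | R ^ 2 ≤ y ^ 2}
  have hA : MeasurableSet A := measurableSet_le measurable_const (by fun_prop)
  have hcheb : R ^ 2 * m.real A ≤ ∫ y, y ^ 2 ∂m :=
    mul_meas_ge_le_integral_of_nonneg (ae_of_all _ fun y => sq_nonneg y) h2 _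
  -- By Chebyshev and `hM`, at least half of the mass lies within distance `R` of the origin; this
  -- is the factor `1 / 2` in the bounds.
  have hAc : 1 / 2 ≤ m.real Aᶜ := by
    rw [probReal_compl_eq_one_sub hA]
    have : 0 < R ^ 2 := by positivity
    nlinarith
  have hpdf := gaussianPDFReal_nonneg 0 v (|t| + R + 1)
  have main : ∀ f : ℝ → ℝ, Integrable f m → (∀ y, 0 ≤ f y) →
      (∀ y ∈ Aᶜ, gaussianPDFReal 0 v (|t| + R + 1) ≤ f y) →
      gaussianPDFReal 0 v (|t| + R + 1) / 2 ≤ ∫ y, f y ∂m := by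
    intro f hf h0 hle
    calc gaussianPDFReal 0 v (|t| + R + 1) / 2
        ≤ m.real Aᶜ * gaussianPDFReal 0 v (|t| + R + 1) := by nlinarith
      _ = ∫ y in Aᶜ, gaussianPDFReal 0 v (|t| + R + 1) ∂m := by simp
      _ ≤ ∫ y in Aᶜ, f y ∂m :=
          setIntegral_mono_on (integrable_const _) hf.integrableOn hA.compl hle
      _ ≤ ∫ y, f y ∂m := setIntegral_le_integral hf (ae_of_all _ h0)
  have habs : ∀ y ∈ Aᶜ, |t - y| ≤ |t| + R := fun y hy => by
    have : |y| ≤ R := abs_le_of_sq_le_sq (not_le.1 (show ¬ R ^ 2 ≤ y ^ 2 from hy)).le hR.le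
    linarith [abs_sub t y]
  have hi := integrable_cdf_sub (m := m) hv t
  rw [cdf_conv_gaussianReal hv]
  refine ⟨main _ hi (fun y => cdf_nonneg _ _) fun y hy => (gaussianPDFReal_le_cdf hv (habs y hy)).1,
    ?_⟩
  have := main _ ((integrable_const 1).sub hi) (fun y => sub_nonneg.2 (cdf_le_one _ _))
    fun y hy => (gaussianPDFReal_le_cdf hv (habs y hy)).2
  simpa [integral_sub (integrable_const (1 : ℝ)) hi] using this

/-- The constant in the growth bound for the monotone rearrangement. -/
noncomputable def growthConst (v : ℝ≥0) (M R : ℝ) : ℝ :=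
  √(2 * M * √(2 * Real.pi * v) * Real.exp (2 * (R + 1) ^ 2 / v))

/-- Chebyshev for the target against the Gaussian lower bound for the tails of the source gives `T²
≤ const * exp ((|t| + R + 1)² / 2v)`. The square root nearly halves the exponent, which leaves room
below the rate `1 / 2v` of the density. -/
lemma abs_monoMap_le (hv : v ≠ 0) (h2 : Integrable (fun y => y ^ 2) m) {R : ℝ}
    (hR : 0 < R) (hM : 2 * ∫ y, y ^ 2 ∂m ≤ R ^ 2) {η : Measure ℝ} [IsProbabilityMeasure η]
    (hη : RegularCDF η) (h2η : Integrable (fun y => y ^ 2) η) {M : ℝ}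
    (hMη : ∫ y, y ^ 2 ∂η ≤ M) (t : ℝ) :
    |monoMap (m.conv (gaussianReal 0 v)) η t| ≤
      growthConst v M R * Real.exp (t ^ 2 / (3 * v)) := by
  have hv' : (0 : ℝ) < v := by exact_mod_cast pos_iff_ne_zero.2 hv
  obtain ⟨h1, h2'⟩ := le_cdf_conv_gaussianReal hv h2 hR hM t
  have hM0 : 0 ≤ M := le_trans (integral_nonneg fun y => sq_nonneg y) hMη
  have hT := ((regularCDF_conv_gaussianReal hv).sq_monoMap_mul_le hη h2η h1 h2').trans hMη
  set T := monoMap (m.conv (gaussianReal 0 v)) η t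
  rw [gaussianPDFReal_zero_apply] at hT
  have hs : 0 < √(2 * Real.pi * v) := Real.sqrt_pos.2 (by positivity)
  set c := √(2 * Real.pi * v)
  rw [growthConst]
  refine abs_le_of_sq_le_sq ?_ (by positivity)
  rw [mul_pow, Real.sq_sqrt (by positivity), ← Real.exp_nat_mul, mul_assoc, ← Real.exp_add]
  have hexp : Real.exp ((|t| + R + 1) ^ 2 / (2 * v)) ≤
      Real.exp (2 * (R + 1) ^ 2 / v + ((2 : ℕ) : ℝ) * (t ^ 2 / (3 * v))) := by
    refine Real.exp_le_exp.2 ?_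
    have : 2 * (R + 1) ^ 2 / v + ((2 : ℕ) : ℝ) * (t ^ 2 / (3 * v)) =
        (4 * (R + 1) ^ 2 + 4 / 3 * t ^ 2) / (2 * v) := by
      push_cast; field_simp; ring
    rw [this]
    gcongr
    have := sq_abs t
    -- Young's inequality `(a + b)² ≤ 4/3 a² + 4 b²`, the source of the `3` in `t² / 3v`.
    nlinarith [sq_nonneg (|t| - 3 * (R + 1))]
  have hmul : Real.exp (-(|t| + R + 1) ^ 2 / (2 * v)) * Real.exp ((|t| + R + 1) ^ 2 / (2 * v)) = 1 := by
    rw [← Real.exp_add, neg_div, neg_add_cancel, Real.exp_zero]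
  calc T ^ 2 = (T ^ 2 * (c⁻¹ * Real.exp (-(|t| + R + 1) ^ 2 / (2 * v)) / 2)) * (2 * c *
        Real.exp ((|t| + R + 1) ^ 2 / (2 * v))) := by
        have : T ^ 2 * (c⁻¹ * Real.exp (-(|t| + R + 1) ^ 2 / (2 * v)) / 2) * (2 * c *
          Real.exp ((|t| + R + 1) ^ 2 / (2 * v))) = T ^ 2 * (c⁻¹ * c) *
            (Real.exp (-(|t| + R + 1) ^ 2 / (2 * v)) * Real.exp ((|t| + R + 1) ^ 2 / (2 * v))) := by
          ring
        rw [this, hmul, inv_mul_cancel₀ hs.ne']; ring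
    _ ≤ M * (2 * c * Real.exp ((|t| + R + 1) ^ 2 / (2 * v))) := by gcongr
    _ ≤ M * (2 * c * Real.exp (2 * (R + 1) ^ 2 / v + ((2 : ℕ) : ℝ) * (t ^ 2 / (3 * v)))) := by
        gcongr
    _ = _ := by ring

end Gaussian

/-! ### Functions of Gaussian growth -/

section Growth

variable {v : ℝ≥0} {K B : ℝ} {g : ℝ → ℝ}

/-- An integrable majorant of `t ↦ g t * φ (t - s)` for `|s| ≤ B` and `|g t| ≤ K exp (t² / 3v)`. -/
noncomputable def gaussMajorant (v : ℝ≥0) (K B t : ℝ) : ℝ :=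
  K * ((√(2 * Real.pi * v))⁻¹ * Real.exp (5 * B ^ 2 / (2 * v))) * Real.exp (-(12 * v : ℝ)⁻¹ * t ^ 2)

/-- Puts the identity in the same growth class as the transport maps, so that `t - T t` is covered
too. -/
lemma abs_le_mul_exp (hv : v ≠ 0) (t : ℝ) : |t| ≤ (1 + 3 * v) * Real.exp (t ^ 2 / (3 * v)) := by
  have hv' : (0 : ℝ) < v := by exact_mod_cast pos_iff_ne_zero.2 hv
  have h1 := Real.add_one_le_exp (t ^ 2 / (3 * v))
  calc |t| ≤ 1 + t ^ 2 := by nlinarith [sq_abs t, sq_nonneg (|t| - 1), abs_nonneg t]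
    _ ≤ (1 + 3 * v) * (t ^ 2 / (3 * v) + 1) := by
        have : (1 + 3 * (v : ℝ)) * (t ^ 2 / (3 * v) + 1) = t ^ 2 / (3 * v) + t ^ 2 + 1 + 3 * v := by
          field_simp
          ring
        rw [this]
        have : 0 ≤ t ^ 2 / (3 * (v : ℝ)) := by positivity
        linarith
    _ ≤ _ := by gcongr

lemma abs_mul_gaussianPDFReal_le (hv : v ≠ 0) {t s y : ℝ} (hy : |y| ≤ K * Real.exp (t ^ 2 / (3 * v)))
    (hs : |s| ≤ B) : |y * gaussianPDFReal 0 v (t - s)| ≤ gaussMajorant v K B t := by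
  have hv' : (0 : ℝ) < v := by exact_mod_cast pos_iff_ne_zero.2 hv
  have hK : 0 ≤ K := by
    have := (abs_nonneg y).trans hy
    exact nonneg_of_mul_nonneg_left this (Real.exp_pos _)
  rw [abs_mul, abs_of_nonneg (gaussianPDFReal_nonneg _ _ _), gaussianPDFReal_zero_apply]
  have hsB : s ^ 2 ≤ B ^ 2 := sq_le_sq' (by linarith [neg_abs_le s]) ((le_abs_self s).trans hs)
  calc |y| * ((√(2 * Real.pi * v))⁻¹ * Real.exp (-(t - s) ^ 2 / (2 * v)))
      ≤ K * Real.exp (t ^ 2 / (3 * v)) *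
        ((√(2 * Real.pi * v))⁻¹ * Real.exp (-(t - s) ^ 2 / (2 * v))) := by gcongr
    _ = K * (√(2 * Real.pi * v))⁻¹ *
        Real.exp (t ^ 2 / (3 * v) + -(t - s) ^ 2 / (2 * v)) := by rw [Real.exp_add]; ring
    _ ≤ K * (√(2 * Real.pi * v))⁻¹ *
        Real.exp (5 * B ^ 2 / (2 * v) + -(12 * v : ℝ)⁻¹ * t ^ 2) := by
        refine mul_le_mul_of_nonneg_left (Real.exp_le_exp.2 ?_) (by positivity)
        have e1 : t ^ 2 / (3 * v) + -(t - s) ^ 2 / (2 * v) =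
          (4 * t ^ 2 - 6 * (t - s) ^ 2) / (12 * v) := by field_simp; ring
        have e2 : 5 * B ^ 2 / (2 * v) + -(12 * v : ℝ)⁻¹ * t ^ 2 =
          (30 * B ^ 2 - t ^ 2) / (12 * v) := by field_simp; ring
        rw [e1, e2]
        refine div_le_div_of_nonneg_right ?_ (by positivity)
        -- The net rate `1/2 - 1/3 = 1/6` is split: half stays as `-t² / 12v`, the other half
        -- absorbs the cross term. The slack is `(t - 6s)²` plus `30 (B² - s²)`.
        nlinarith [sq_nonneg (t - 6 * s)]
    _ = _ := by rw [Real.exp_add, gaussMajorant]; ring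

lemma integrable_gaussMajorant (hv : v ≠ 0) (K B : ℝ) : Integrable (gaussMajorant v K B) := by
  have hv' : (0 : ℝ) < v := by exact_mod_cast pos_iff_ne_zero.2 hv
  exact (integrable_exp_neg_mul_sq (b := (12 * v : ℝ)⁻¹) (by positivity)).const_mul _

lemma integrable_gaussMajorant_mul (hv : v ≠ 0) (K B C : ℝ) :
    Integrable fun t => gaussMajorant v K B t * (|t| + C) := by
  have hv' : (0 : ℝ) < v := by exact_mod_cast pos_iff_ne_zero.2 hv
  have h1 : Integrable fun t => gaussMajorant v K B t * |t| := by
    have := (integrable_mul_exp_neg_mul_sq (b := (12 * v : ℝ)⁻¹) (by positivity)).abs.const_mul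
      (K * ((√(2 * Real.pi * v))⁻¹ * Real.exp (5 * B ^ 2 / (2 * v))))
    refine this.congr (ae_of_all _ fun t => ?_)
    simp only [abs_mul, Real.abs_exp, gaussMajorant]
    ring
  simpa only [mul_add, Pi.add_def] using h1.add ((integrable_gaussMajorant hv K B).mul_const C)

/-- Gaussian integration by parts for monotone functions of Gaussian growth. -/
lemma integrable_deriv_mul_gaussianPDFReal (hv : v ≠ 0) (hg : Differentiable ℝ g)
    (hmono : Monotone g) (hK : ∀ t, |g t| ≤ K * Real.exp (t ^ 2 / (3 * v))) (s : ℝ) :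
    Integrable (fun t => deriv g t * gaussianPDFReal 0 v (t - s)) ∧
      Integrable (fun t => g t * ((t - s) / v * gaussianPDFReal 0 v (t - s))) ∧
      ∫ t, deriv g t * gaussianPDFReal 0 v (t - s) =
        ∫ t, g t * ((t - s) / v * gaussianPDFReal 0 v (t - s)) := by
  have hv' : (0 : ℝ) < v := by exact_mod_cast pos_iff_ne_zero.2 hv
  have hφc := continuous_gaussianPDFReal v
  have hgc := hg.continuous
  set φ : ℝ → ℝ := fun t => gaussianPDFReal 0 v (t - s) with hφ
  set φ' : ℝ → ℝ := fun t => -((t - s) / v * gaussianPDFReal 0 v (t - s)) with hφ'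
  have hφd : ∀ t, HasDerivAt φ (φ' t) t := fun t => by
    have := (hasDerivAt_gaussianPDFReal hv (t - s)).comp t ((hasDerivAt_id t).sub_const s)
    simpa [φ', Function.comp_def] using this
  have hφcont : Continuous φ := by fun_prop
  have hφ'cont : Continuous φ' := by fun_prop
  have hbd : ∀ t, |g t * φ t| ≤ gaussMajorant v K |s| t := fun t =>
    abs_mul_gaussianPDFReal_le hv (hK t) le_rfl
  have hgφ : Integrable fun t => g t * φ t :=
    (integrable_gaussMajorant hv K |s|).mono' (by fun_prop) (ae_of_all _ hbd)
  have hgφ' : Integrable fun t => g t * φ' t := by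
    refine ((integrable_gaussMajorant_mul hv K |s| |s|).div_const v).mono' (by fun_prop)
      (ae_of_all _ fun t => ?_)
    have e : g t * φ' t = -((g t * φ t) * (t - s) / v) := by simp only [φ, φ']; ring
    rw [e, norm_neg, norm_div, norm_mul, Real.norm_eq_abs, Real.norm_eq_abs, Real.norm_eq_abs,
      abs_of_pos hv']
    gcongr
    · exact (abs_nonneg _).trans (hbd t)
    · exact hbd t
    · exact abs_sub t s
  -- Monotonicity replaces any continuity of `deriv g`: a nonnegative derivative is integrable on
  -- bounded intervals.
  have hgi : ∀ a b, IntervalIntegrable (deriv g) volume a b := fun a b =>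
    intervalIntegral.intervalIntegrable_deriv_of_nonneg hgc.continuousOn
      (fun x _ => (hg x).hasDerivAt) (fun x _ => hmono.deriv_nonneg)
  have hnn : ∀ t, 0 ≤ deriv g t * φ t := fun t =>
    mul_nonneg hmono.deriv_nonneg (gaussianPDFReal_nonneg _ _ _)
  have hint : Integrable fun t => deriv g t * φ t := by
    set C := K * ((√(2 * Real.pi * v))⁻¹ * Real.exp (5 * |s| ^ 2 / (2 * v))) with hC
    have hK0 : 0 ≤ K := by
      have := (abs_nonneg (g 0)).trans (hK 0)
      exact nonneg_of_mul_nonneg_left this (Real.exp_pos _)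
    have hC0 : 0 ≤ C := by positivity
    have hbdC : ∀ t, |g t * φ t| ≤ C := fun t => (hbd t).trans <| by
      rw [gaussMajorant]
      refine mul_le_of_le_one_right hC0 (Real.exp_le_one_iff.2 ?_)
      rw [neg_mul]
      exact neg_nonpos.2 (by positivity)
    -- The integrand is nonnegative, so bounded integrals over `[-n, n]` suffice. Integration by
    -- parts there bounds the two boundary terms by `2 * C` and the rest by the integral of `|g
    -- φ'|`.
    refine integrable_of_intervalIntegral_norm_bounded (μ := volume) (l := atTop)
      (a := fun n : ℕ => -(n : ℝ)) (b := fun n : ℕ => (n : ℝ))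
      (2 * C + ∫ t, |g t * φ' t|) (fun n => ?_)
      (tendsto_neg_atTop_atBot.comp tendsto_natCast_atTop_atTop) tendsto_natCast_atTop_atTop
      (Eventually.of_forall fun n => ?_)
    · exact (((hgi _ _).mul_continuousOn hφcont.continuousOn).1)
    · have hibp := intervalIntegral.integral_deriv_mul_eq_sub (a := -(n : ℝ)) (b := n) (u := g)
        (v := φ) (fun x _ => (hg x).hasDerivAt) (fun x _ => hφd x) (hgi _ _)
        (hφ'cont.intervalIntegrable _ _)
      rw [intervalIntegral.integral_add ((hgi _ _).mul_continuousOn hφcont.continuousOn)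
        (hgφ'.intervalIntegrable)] at hibp
      have h1 : ∫ x in -(n : ℝ)..n, ‖deriv g x * φ x‖ = ∫ x in -(n : ℝ)..n, deriv g x * φ x := by
        congr 1
        ext x
        rw [Real.norm_eq_abs, abs_of_nonneg (hnn x)]
      have h2 : |∫ x in -(n : ℝ)..n, g x * φ' x| ≤ ∫ t, |g t * φ' t| := by
        refine (intervalIntegral.norm_integral_le_integral_norm_uIoc (f := fun x => g x * φ' x)).trans ?_
        exact setIntegral_le_integral hgφ'.norm (ae_of_all _ fun x => norm_nonneg _)
      rw [h1]
      have h3 := (abs_le.1 h2).1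
      have h4 := (abs_le.1 (hbdC n)).2
      have h5 := (abs_le.1 (hbdC (-n))).1
      linarith
  have hibp := integral_mul_deriv_eq_deriv_mul_of_integrable (u := g) (v := φ)
    (fun x _ => (hg x).hasDerivAt) (fun x _ => hφd x) hgφ' hint hgφ
  have hneg : (fun t => g t * ((t - s) / v * gaussianPDFReal 0 v (t - s))) =
      fun t => -(g t * φ' t) := by ext t; simp only [φ']; ring
  refine ⟨hint, hneg ▸ hgφ'.neg, ?_⟩
  rw [hneg, integral_neg]
  linarith

end Growth

/-! ### Slices of regularized measures -/

section Slices

variable {k : ℕ} {σ : ℝ}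

instance (μ : P2 k) : IsProbabilityMeasure μ.1 := μ.2.1

instance (k : ℕ) (σ : ℝ) : IsProbabilityMeasure (gauss k σ) := by
  unfold gauss; infer_instance

instance (σ : ℝ) (μ : Measure (Euc k)) [IsProbabilityMeasure μ] :
    IsProbabilityMeasure (reg σ μ) := by
  unfold reg; infer_instance

lemma continuous_inner_sph (θ : Sph k) : Continuous fun x : Euc k => inner ℝ (θ : Euc k) x := by
  fun_prop

instance (θ : Sph k) (μ : Measure (Euc k)) [IsProbabilityMeasure μ] :
    IsProbabilityMeasure (slice θ μ) :=
  Measure.isProbabilityMeasure_map (continuous_inner_sph θ).measurable.aemeasurable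

instance isProbabilityMeasure_unif [NeZero k] : IsProbabilityMeasure (unif k) := by
  have : Nonempty (Fin k) := ⟨⟨0, Nat.pos_of_ne_zero (NeZero.ne k)⟩⟩
  have h0 : (volume : Measure (Euc k)).toSphere ≠ 0 := Measure.toSphere_ne_zero _
  exact ⟨by
    rw [unif, Measure.smul_apply, smul_eq_mul]
    exact ENNReal.inv_mul_cancel (Measure.measure_univ_ne_zero.2 h0) (measure_ne_top _ _)⟩

lemma norm_sph (θ : Sph k) : ‖(θ : Euc k)‖ = 1 := by simp

lemma abs_inner_sph_le (θ : Sph k) (x : Euc k) : |inner ℝ (θ : Euc k) x| ≤ ‖x‖ := by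
  simpa [norm_sph] using abs_real_inner_le_norm (θ : Euc k) x

/-- The variance `σ²` as a nonnegative real. -/
noncomputable def sigmaSq (σ : ℝ) : ℝ≥0 := ⟨σ ^ 2, sq_nonneg σ⟩

lemma coe_sigmaSq (σ : ℝ) : (sigmaSq σ : ℝ) = σ ^ 2 := rfl

lemma sigmaSq_ne_zero (hσ : 0 < σ) : sigmaSq σ ≠ 0 := by
  rw [← NNReal.coe_ne_zero, coe_sigmaSq]; positivity

/-- Comparison of characteristic functions; all directions give the same law because `‖θ‖ = 1`. -/
lemma slice_gauss (θ : Sph k) : slice θ (gauss k σ) = gaussianReal 0 (sigmaSq σ) := by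
  have hS : (σ ^ 2 • (1 : Matrix (Fin k) (Fin k) ℝ)).PosSemidef :=
    Matrix.PosSemidef.one.smul (sq_nonneg σ)
  refine Measure.ext_of_charFun ?_
  ext t
  have h1 : charFun (slice θ (gauss k σ)) t = charFun (gauss k σ) (t • (θ : Euc k)) := by
    rw [charFun_apply, charFun_apply, slice, integral_map
      (continuous_inner_sph θ).measurable.aemeasurable (by fun_prop)]
    congr 1
    ext x
    simp [real_inner_smul_right, real_inner_comm, mul_comm]
  have h2 : (t • (θ : Euc k)).ofLp ⬝ᵥ ((σ ^ 2 • (1 : Matrix (Fin k) (Fin k) ℝ)).mulVec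
      (t • (θ : Euc k)).ofLp) = σ ^ 2 * t ^ 2 := by
    have h3 : (θ : Euc k).ofLp ⬝ᵥ (θ : Euc k).ofLp = 1 := by
      have := real_inner_self_eq_norm_sq (θ : Euc k)
      rw [norm_sph, PiLp.inner_apply, one_pow] at this
      exact this
    simp only [Matrix.smul_mulVec, Matrix.one_mulVec, WithLp.ofLp_smul, dotProduct_smul,
      smul_dotProduct, h3, smul_eq_mul]
    ring
  rw [h1, gauss, charFun_multivariateGaussian hS, h2, charFun_gaussianReal, coe_sigmaSq]
  simp

/-- Projection is linear, so it commutes with convolution. This reduces the problem to Gaussian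
smoothing on the line. -/
lemma slice_reg (θ : Sph k) (μ : Measure (Euc k)) [IsProbabilityMeasure μ] :
    slice θ (reg σ μ) = (slice θ μ).conv (gaussianReal 0 (sigmaSq σ)) := by
  rw [← slice_gauss (k := k) θ]
  exact Measure.map_conv_continuousLinearMap (innerSL ℝ (θ : Euc k))

lemma regularCDF_slice_reg (hσ : 0 < σ) (θ : Sph k) (μ : Measure (Euc k))
    [IsProbabilityMeasure μ] : RegularCDF (slice θ (reg σ μ)) := by
  rw [slice_reg]; exact regularCDF_conv_gaussianReal (sigmaSq_ne_zero hσ)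

lemma memLp_id_gauss : MemLp id 2 (gauss k σ) := by
  unfold gauss; exact IsGaussian.memLp_two_id

lemma memLp_fst_add_snd {μ : Measure (Euc k)} [IsProbabilityMeasure μ] (h : MemLp id 2 μ) :
    MemLp (fun p : Euc k × Euc k => p.1 + p.2) 2 (μ.prod (gauss k σ)) :=
  (h.comp_measurePreserving measurePreserving_fst).add
    (memLp_id_gauss.comp_measurePreserving measurePreserving_snd)

lemma memLp_id_reg {μ : Measure (Euc k)} [IsProbabilityMeasure μ] (h : MemLp id 2 μ) :
    MemLp id 2 (reg σ μ) :=
  (memLp_map_measure_iff aestronglyMeasurable_id (by fun_prop)).2 (memLp_fst_add_snd h)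

lemma memLp_inner {μ : Measure (Euc k)} (h : MemLp id 2 μ) (θ : Sph k) :
    MemLp (fun x : Euc k => inner ℝ (θ : Euc k) x) 2 μ :=
  h.mono (continuous_inner_sph θ).aestronglyMeasurable
    (ae_of_all _ fun x => by simpa using abs_inner_sph_le θ x)

lemma memLp_id_slice {μ : Measure (Euc k)} (h : MemLp id 2 μ) (θ : Sph k) :
    MemLp id 2 (slice θ μ) :=
  (memLp_map_measure_iff aestronglyMeasurable_id
    (continuous_inner_sph θ).measurable.aemeasurable).2 (memLp_inner h θ)

lemma integrable_sq_slice {μ : Measure (Euc k)} (h : MemLp id 2 μ) (θ : Sph k) :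
    Integrable (fun y => y ^ 2) (slice θ μ) := (memLp_id_slice h θ).integrable_sq

lemma integral_sq_slice_le {μ : Measure (Euc k)} [IsProbabilityMeasure μ] (h : MemLp id 2 μ)
    (θ : Sph k) : ∫ y, y ^ 2 ∂(slice θ μ) ≤ ∫ x, ‖x‖ ^ 2 ∂μ := by
  rw [slice, integral_map (continuous_inner_sph θ).measurable.aemeasurable (by fun_prop)]
  refine integral_mono (memLp_inner h θ).integrable_sq
    (h.integrable_norm_pow two_ne_zero) fun x => ?_
  have := abs_inner_sph_le θ x
  simpa [sq_abs] using pow_le_pow_left₀ (abs_nonneg _) this 2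

lemma transportMap_eq (μ ν : P2 k) (θ : Sph k) :
    transportMap σ μ ν θ = monoMap (slice θ (reg σ μ.1)) (slice θ (reg σ ν.1)) := rfl

/-- The constant is independent of `θ` and depends on `μ` only through `R`; this uniformity feeds
every dominated convergence argument below. -/
lemma abs_transportMap_le (hσ : 0 < σ) {μ : P2 k} (ν : P2 k) {R : ℝ} (hR : 0 < R)
    (hμ : 2 * ∫ x, ‖x‖ ^ 2 ∂μ.1 ≤ R ^ 2) (θ : Sph k) (t : ℝ) :
    |transportMap σ μ ν θ t| ≤ growthConst (sigmaSq σ) (∫ y, ‖y‖ ^ 2 ∂(reg σ ν.1)) R *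
      Real.exp (t ^ 2 / (3 * sigmaSq σ)) := by
  rw [transportMap_eq, slice_reg θ μ.1]
  have hν := memLp_id_reg (σ := σ) ν.2.2
  refine abs_monoMap_le (sigmaSq_ne_zero hσ) (integrable_sq_slice μ.2.2 θ) hR ?_
    (regularCDF_slice_reg hσ θ ν.1) (integrable_sq_slice hν θ) (integral_sq_slice_le hν θ) t
  linarith [integral_sq_slice_le μ.2.2 θ]

lemma differentiable_transportMap (hσ : 0 < σ) (μ ν : P2 k) (θ : Sph k) :
    Differentiable ℝ (transportMap σ μ ν θ) :=
  (regularCDF_slice_reg hσ θ μ.1).differentiable_monoMap (regularCDF_slice_reg hσ θ ν.1)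

lemma monotone_transportMap (hσ : 0 < σ) (μ ν : P2 k) (θ : Sph k) :
    Monotone (transportMap σ μ ν θ) :=
  ((regularCDF_slice_reg hσ θ μ.1).strictMono_monoMap (regularCDF_slice_reg hσ θ ν.1)).monotone

/-! ### Stability of the transport maps -/

lemma exists_coupling_of_W2_lt {μ' μ : P2 k} {δ : ℝ} (hδ : 0 < δ) (h : W2 μ' μ < δ) :
    ∃ π ∈ couplings μ'.1 μ.1, MemLp (fun p : Euc k × Euc k => p.1 - p.2) 2 π ∧
      ∫ p, ‖p.1 - p.2‖ ^ 2 ∂π < 2 * δ ^ 2 :=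
  exists_coupling_lt μ'.2.2 μ.2.2 ((Real.sqrt_lt' hδ).1 h)

lemma integral_norm_sq_le_of_W2_lt {μ' μ : P2 k} {δ : ℝ} (hδ : 0 < δ) (h : W2 μ' μ < δ) :
    ∫ x, ‖x‖ ^ 2 ∂μ'.1 ≤ 2 * ∫ x, ‖x‖ ^ 2 ∂μ.1 + 4 * δ ^ 2 := by
  obtain ⟨π, ⟨hπ, h1, h2⟩, hm, hlt⟩ := exists_coupling_of_W2_lt hδ h
  have e1 : ∫ x, ‖x‖ ^ 2 ∂μ'.1 = ∫ p, ‖p.1‖ ^ 2 ∂π := by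
    rw [← h1, integral_map measurable_fst.aemeasurable (by fun_prop)]
  have e2 : ∫ x, ‖x‖ ^ 2 ∂μ.1 = ∫ p, ‖p.2‖ ^ 2 ∂π := by
    rw [← h2, integral_map measurable_snd.aemeasurable (by fun_prop)]
  have i1 : Integrable (fun p : Euc k × Euc k => ‖p.1‖ ^ 2) π := by
    have := μ'.2.2.integrable_norm_pow two_ne_zero
    rw [← h1] at this
    exact this.comp_measurable measurable_fst
  have i2 : Integrable (fun p : Euc k × Euc k => ‖p.2‖ ^ 2) π := by
    have := μ.2.2.integrable_norm_pow two_ne_zero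
    rw [← h2] at this
    exact this.comp_measurable measurable_snd
  have i3 : Integrable (fun p : Euc k × Euc k => ‖p.1 - p.2‖ ^ 2) π :=
    hm.integrable_norm_pow two_ne_zero
  rw [e1, e2]
  calc ∫ p, ‖p.1‖ ^ 2 ∂π ≤ ∫ p, (2 * ‖p.2‖ ^ 2 + 2 * ‖p.1 - p.2‖ ^ 2) ∂π := by
        refine integral_mono i1 ((i2.const_mul 2).add (i3.const_mul 2)) fun p => ?_
        have h3 : ‖p.1‖ ≤ ‖p.2‖ + ‖p.1 - p.2‖ := by
          simpa using norm_add_le p.2 (p.1 - p.2)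
        have := pow_le_pow_left₀ (norm_nonneg _) h3 2
        nlinarith [sq_nonneg (‖p.2‖ - ‖p.1 - p.2‖)]
    _ = 2 * ∫ p, ‖p.2‖ ^ 2 ∂π + 2 * ∫ p, ‖p.1 - p.2‖ ^ 2 ∂π := by
        rw [integral_add (i2.const_mul 2) (i3.const_mul 2), integral_const_mul, integral_const_mul]
    _ ≤ _ := by linarith

lemma cdf_slice_reg (hσ : 0 < σ) (μ : Measure (Euc k)) [IsProbabilityMeasure μ] (θ : Sph k)
    (t : ℝ) : cdf (slice θ (reg σ μ)) t =
      ∫ x, cdf (gaussianReal 0 (sigmaSq σ)) (t - inner ℝ (θ : Euc k) x) ∂μ := by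
  rw [slice_reg, cdf_conv_gaussianReal (sigmaSq_ne_zero hσ), slice, integral_map
    (continuous_inner_sph θ).measurable.aemeasurable]
  exact ((cdf _).mono.measurable.comp (by fun_prop)).aestronglyMeasurable

/-- The Gaussian distribution function is Lipschitz, so its increments can be integrated against an
almost optimal coupling of `μ'` and `μ`. -/
lemma abs_cdf_slice_reg_sub_le (hσ : 0 < σ) (μ' μ : P2 k) (θ' θ : Sph k) (t' t : ℝ) :
    |cdf (slice θ' (reg σ μ'.1)) t' - cdf (slice θ (reg σ μ.1)) t| ≤
      (√(2 * Real.pi * sigmaSq σ))⁻¹ *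
        (|t' - t| + 2 * W2 μ' μ + ‖(θ' : Euc k) - θ‖ * ∫ x, ‖x‖ ∂μ.1) := by
  set c := (√(2 * Real.pi * sigmaSq σ))⁻¹
  have hc : 0 ≤ c := by positivity
  have main : ∀ δ > W2 μ' μ, |cdf (slice θ' (reg σ μ'.1)) t' - cdf (slice θ (reg σ μ.1)) t| ≤
      c * (|t' - t| + 2 * δ + ‖(θ' : Euc k) - θ‖ * ∫ x, ‖x‖ ∂μ.1) := by
    intro δ hδ
    have hδ0 : 0 < δ := (Real.sqrt_nonneg _).trans_lt hδ
    obtain ⟨π, ⟨hπ, h1, h2⟩, hm, hlt⟩ := exists_coupling_of_W2_lt hδ0 hδ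
    set Φ := cdf (gaussianReal 0 (sigmaSq σ))
    have hΦ : Measurable Φ := Φ.mono.measurable
    have e1 : cdf (slice θ' (reg σ μ'.1)) t' = ∫ p, Φ (t' - inner ℝ (θ' : Euc k) p.1) ∂π := by
      rw [cdf_slice_reg hσ, ← h1, integral_map measurable_fst.aemeasurable]
      exact (hΦ.comp (by fun_prop)).aestronglyMeasurable
    have e2 : cdf (slice θ (reg σ μ.1)) t = ∫ p, Φ (t - inner ℝ (θ : Euc k) p.2) ∂π := by
      rw [cdf_slice_reg hσ, ← h2, integral_map measurable_snd.aemeasurable]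
      exact (hΦ.comp (by fun_prop)).aestronglyMeasurable
    have e3 : ∫ x, ‖x‖ ∂μ.1 = ∫ p, ‖p.2‖ ∂π := by
      rw [← h2, integral_map measurable_snd.aemeasurable (by fun_prop)]
    have i0 : ∀ f : Euc k × Euc k → ℝ, Measurable f → Integrable (fun p => Φ (f p)) π :=
      fun f hf => Integrable.of_bound (C := 1) (hΦ.comp hf).aestronglyMeasurable
        (ae_of_all _ fun p => by
          rw [Real.norm_eq_abs, abs_of_nonneg (cdf_nonneg _ _)]; exact cdf_le_one _ _)
    have i2 : Integrable (fun p : Euc k × Euc k => ‖p.2‖) π := by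
      have := (μ.2.2.integrable one_le_two).norm
      rw [← h2] at this
      exact this.comp_measurable measurable_snd
    have i3 : Integrable (fun p : Euc k × Euc k => ‖p.1 - p.2‖ ^ 2) π :=
      hm.integrable_norm_pow two_ne_zero
    have i4 : Integrable (fun p : Euc k × Euc k => (‖p.1 - p.2‖ ^ 2 / δ + δ) / 2) π :=
      ((i3.div_const δ).add (integrable_const δ)).div_const 2
    have hpt : ∀ p : Euc k × Euc k, ‖Φ (t' - inner ℝ (θ' : Euc k) p.1) -
        Φ (t - inner ℝ (θ : Euc k) p.2)‖ ≤ c * (|t' - t| + (‖p.1 - p.2‖ ^ 2 / δ + δ) / 2 +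
          ‖(θ' : Euc k) - θ‖ * ‖p.2‖) := by
      intro p
      refine (abs_cdf_gaussianReal_sub_le (sigmaSq_ne_zero hσ) _ _).trans ?_
      gcongr
      have e : t' - inner ℝ (θ' : Euc k) p.1 - (t - inner ℝ (θ : Euc k) p.2) =
          (t' - t) - inner ℝ (θ' : Euc k) (p.1 - p.2) - inner ℝ ((θ' : Euc k) - θ) p.2 := by
        rw [inner_sub_right, inner_sub_left]; ring
      rw [e]
      refine (abs_sub _ _).trans (add_le_add ((abs_sub _ _).trans (add_le_add le_rfl ?_))
        (abs_real_inner_le_norm _ _))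
      refine (abs_inner_sph_le θ' _).trans ?_
      -- By the arithmetic-geometric mean inequality the distance is at most `(‖p.1 - p.2‖² / δ + δ)
      -- / 2`. The second moment is below `2δ²` (the cost carries a factor `1/2`), so this
      -- integrates to at most `3δ/2 ≤ 2δ`.
      have : ‖p.1 - p.2‖ ^ 2 / δ + δ - 2 * ‖p.1 - p.2‖ = (‖p.1 - p.2‖ - δ) ^ 2 / δ := by
        field_simp; ring
      have h5 : 0 ≤ (‖p.1 - p.2‖ - δ) ^ 2 / δ := by positivity
      linarith
    rw [e1, e2, e3, ← integral_sub (i0 _ (by fun_prop)) (i0 _ (by fun_prop))]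
    refine (norm_integral_le_of_norm_le ((((integrable_const |t' - t|).add i4).add
      (i2.const_mul ‖(θ' : Euc k) - θ‖)).const_mul c) (ae_of_all _ hpt)).trans ?_
    rw [integral_const_mul]
    refine mul_le_mul_of_nonneg_left ?_ hc
    simp only [Pi.add_apply]
    have i5 : Integrable (fun p : Euc k × Euc k =>
        |t' - t| + (‖p.1 - p.2‖ ^ 2 / δ + δ) / 2) π := (integrable_const _).add i4
    rw [integral_add i5 (i2.const_mul _),
      integral_add (integrable_const _) i4, integral_const_mul, integral_div,
      integral_add (i3.div_const δ) (integrable_const δ), integral_div]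
    simp only [integral_const, probReal_univ, one_smul]
    have : (∫ p, ‖p.1 - p.2‖ ^ 2 ∂π) / δ ≤ 2 * δ := by
      rw [div_le_iff₀ hδ0]; nlinarith
    linarith
  -- Almost optimal couplings are enough: `δ` decreases to the distance.
  refine ge_of_tendsto (f := fun δ => c * (|t' - t| + 2 * δ + ‖(θ' : Euc k) - θ‖ * ∫ x, ‖x‖ ∂μ.1))
    (x := 𝓝[>] (W2 μ' μ)) ?_ (eventually_mem_nhdsWithin.mono main)
  exact (Continuous.tendsto (by fun_prop) _).mono_left nhdsWithin_le_nhds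

lemma W2_self (μ : P2 k) : W2 μ μ = 0 := by
  have h := W2sq_map_le μ.2.2 μ.2.2
  simp only [sub_self, norm_zero, Measure.map_id] at h
  rw [W2, Real.sqrt_eq_zero']
  simpa using h

lemma tendsto_cdf_slice_reg (hσ : 0 < σ) {ι : Type*} {l : Filter ι} {μs : ι → P2 k} {μ : P2 k}
    {θs : ι → Sph k} {θ : Sph k} {ts : ι → ℝ} {t : ℝ}
    (hμ : Tendsto (fun i => W2 (μs i) μ) l (𝓝 0)) (hθ : Tendsto θs l (𝓝 θ))
    (ht : Tendsto ts l (𝓝 t)) :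
    Tendsto (fun i => cdf (slice (θs i) (reg σ (μs i).1)) (ts i)) l
      (𝓝 (cdf (slice θ (reg σ μ.1)) t)) := by
  rw [tendsto_iff_norm_sub_tendsto_zero]
  refine squeeze_zero (fun i => norm_nonneg _)
    (fun i => abs_cdf_slice_reg_sub_le hσ (μs i) μ (θs i) θ (ts i) t) ?_
  have h1 : Tendsto (fun i => |ts i - t|) l (𝓝 0) := by
    simpa using (ht.sub_const t).abs
  have h2 : Tendsto (fun i => ‖(θs i : Euc k) - θ‖) l (𝓝 0) :=
    tendsto_iff_norm_sub_tendsto_zero.1 ((continuous_subtype_val.tendsto θ).comp hθ)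
  simpa using ((h1.add (hμ.const_mul 2)).add (h2.mul_const (∫ x, ‖x‖ ∂μ.1))).const_mul
    (√(2 * Real.pi * sigmaSq σ))⁻¹

/-- Stated along a filter with `W2` tending to `0`, since `P2 k` carries no topology. It serves both
for continuity in `(θ, t)` at fixed `μ` and for convergence along laws of random vectors. -/
lemma tendsto_transportMap (hσ : 0 < σ) (ν : P2 k) {ι : Type*} {l : Filter ι} {μs : ι → P2 k}
    {μ : P2 k} {θs : ι → Sph k} {θ : Sph k} {ts : ι → ℝ} {t : ℝ}
    (hμ : Tendsto (fun i => W2 (μs i) μ) l (𝓝 0)) (hθ : Tendsto θs l (𝓝 θ))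
    (ht : Tendsto ts l (𝓝 t)) :
    Tendsto (fun i => transportMap σ (μs i) ν (θs i) (ts i)) l (𝓝 (transportMap σ μ ν θ t)) :=
  RegularCDF.tendsto_monoMap (fun i => regularCDF_slice_reg hσ _ _)
    (fun i => regularCDF_slice_reg hσ _ _) (regularCDF_slice_reg hσ _ _)
    (regularCDF_slice_reg hσ _ _)
    (fun x => tendsto_cdf_slice_reg hσ (by simpa only [W2_self] using tendsto_const_nhds) hθ
      tendsto_const_nhds) (tendsto_cdf_slice_reg hσ hμ hθ ht)

lemma continuous_transportMap (hσ : 0 < σ) (μ ν : P2 k) :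
    Continuous fun p : Sph k × ℝ => transportMap σ μ ν p.1 p.2 :=
  continuous_iff_continuousAt.2 fun p =>
    tendsto_transportMap hσ ν (by simpa only [W2_self] using tendsto_const_nhds)
      (continuous_fst.tendsto p) (continuous_snd.tendsto p)

end Slices

/-! ### The derivative field -/

section Field

variable {k : ℕ} {σ : ℝ}

/-- The candidate for the `L`-derivative: the average over `θ` of
`θ 𝔼[θᵀ(x + N) - T_θ(θᵀ(x + N))]`, written through the density of `θᵀ(x + N)`. -/
noncomputable def gradField (σ : ℝ) (ν μ : P2 k) (x : Euc k) : Euc k :=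
  ∫ p : ℝ × Sph k, ((p.1 - transportMap σ μ ν p.2 p.1) *
    gaussianPDFReal 0 (sigmaSq σ) (p.1 - inner ℝ (p.2 : Euc k) x)) • (p.2 : Euc k)
    ∂((volume : Measure ℝ).prod (unif k))

lemma continuous_transportMap_swap (hσ : 0 < σ) (μ ν : P2 k) :
    Continuous fun p : ℝ × Sph k => transportMap σ μ ν p.2 p.1 :=
  continuous_iff_continuousAt.2 fun p =>
    tendsto_transportMap hσ ν (by simpa only [W2_self] using tendsto_const_nhds)
      (continuous_snd.tendsto p) (continuous_fst.tendsto p)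

/-- The growth constant of `t ↦ t - T_θ t`. -/
noncomputable def fieldConst (σ : ℝ) (ν : P2 k) (R : ℝ) : ℝ :=
  1 + 3 * sigmaSq σ + growthConst (sigmaSq σ) (∫ y, ‖y‖ ^ 2 ∂(reg σ ν.1)) R

lemma abs_sub_transportMap_le (hσ : 0 < σ) {μ : P2 k} (ν : P2 k) {R : ℝ} (hR : 0 < R)
    (hμ : 2 * ∫ x, ‖x‖ ^ 2 ∂μ.1 ≤ R ^ 2) (θ : Sph k) (t : ℝ) :
    |t - transportMap σ μ ν θ t| ≤ fieldConst σ ν R * Real.exp (t ^ 2 / (3 * sigmaSq σ)) := by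
  refine (abs_sub _ _).trans ?_
  rw [fieldConst, add_mul]
  exact add_le_add (abs_le_mul_exp (sigmaSq_ne_zero hσ) t) (abs_transportMap_le hσ ν hR hμ θ t)

/-- A radius that controls the second moment of every measure close to `μ`. -/
noncomputable def momentRadius (μ : P2 k) : ℝ := 4 * ∫ x, ‖x‖ ^ 2 ∂μ.1 + 8

lemma momentRadius_pos (μ : P2 k) : 0 < momentRadius μ := by
  have : 0 ≤ ∫ x, ‖x‖ ^ 2 ∂μ.1 := integral_nonneg fun x => sq_nonneg _
  rw [momentRadius]; linarith

lemma two_mul_integral_le_of_W2_lt {μ' μ : P2 k} (h : W2 μ' μ < 1) :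
    2 * ∫ x, ‖x‖ ^ 2 ∂μ'.1 ≤ momentRadius μ ^ 2 := by
  have h1 := integral_norm_sq_le_of_W2_lt one_pos h
  have : 0 ≤ ∫ x, ‖x‖ ^ 2 ∂μ.1 := integral_nonneg fun x => sq_nonneg _
  -- With `m` the second moment of `μ`, that of `μ'` is at most `2m + 4`, and `4m + 8 ≥ 1` is below
  -- its own square.
  rw [momentRadius]
  nlinarith

lemma two_mul_integral_le (μ : P2 k) : 2 * ∫ x, ‖x‖ ^ 2 ∂μ.1 ≤ momentRadius μ ^ 2 :=
  two_mul_integral_le_of_W2_lt (by rw [W2_self]; exact one_pos)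

/-- The derivative of the integrand of `gradField` in `x`. -/
noncomputable def derivIntegrand (σ : ℝ) (ν μ : P2 k) (x : Euc k) (p : ℝ × Sph k) :
    Euc k →L[ℝ] Euc k :=
  ((p.1 - transportMap σ μ ν p.2 p.1) * ((p.1 - inner ℝ (p.2 : Euc k) x) / sigmaSq σ *
    gaussianPDFReal 0 (sigmaSq σ) (p.1 - inner ℝ (p.2 : Euc k) x))) •
    InnerProductSpace.rankOne ℝ (p.2 : Euc k) (p.2 : Euc k)

lemma continuous_rankOne_sph :
    Continuous fun θ : Sph k => InnerProductSpace.rankOne ℝ (θ : Euc k) (θ : Euc k) := by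
  have : (fun θ : Sph k => InnerProductSpace.rankOne ℝ (θ : Euc k) (θ : Euc k)) = fun θ : Sph k =>
      (ContinuousLinearMap.smulRightL ℝ (Euc k) (Euc k) (innerSL ℝ (θ : Euc k))) (θ : Euc k) := by
    ext θ x; simp
  rw [this]
  fun_prop

lemma continuous_derivIntegrand (hσ : 0 < σ) (ν μ : P2 k) (x : Euc k) :
    Continuous (derivIntegrand σ ν μ x) := by
  have := continuous_transportMap_swap hσ μ ν
  have hφ := continuous_gaussianPDFReal (sigmaSq σ)
  have h2 : Continuous fun p : ℝ × Sph k =>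
    InnerProductSpace.rankOne ℝ (p.2 : Euc k) (p.2 : Euc k) :=
    continuous_rankOne_sph.comp continuous_snd
  unfold derivIntegrand
  fun_prop

lemma norm_derivIntegrand_le (hσ : 0 < σ) (ν μ : P2 k) {x : Euc k} {B : ℝ} (hx : ‖x‖ ≤ B)
    (p : ℝ × Sph k) : ‖derivIntegrand σ ν μ x p‖ ≤
      gaussMajorant (sigmaSq σ) (fieldConst σ ν (momentRadius μ)) B p.1 *
        (|p.1| + B) / sigmaSq σ := by
  have hs : |inner ℝ (p.2 : Euc k) x| ≤ B := (abs_inner_sph_le p.2 x).trans hx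
  have h1 := abs_mul_gaussianPDFReal_le (sigmaSq_ne_zero hσ) (abs_sub_transportMap_le hσ ν
    (momentRadius_pos μ) (two_mul_integral_le μ) p.2 p.1) hs
  have e : ∀ a b c d : ℝ, a * (b / c * d) = (a * d) * b / c := fun a b c d => by ring
  rw [derivIntegrand, norm_smul, InnerProductSpace.norm_rankOne, norm_sph, mul_one, mul_one, e,
    norm_div, norm_mul, Real.norm_eq_abs, Real.norm_eq_abs, Real.norm_eq_abs,
    abs_of_nonneg (sigmaSq σ).coe_nonneg]
  gcongr
  · exact (abs_nonneg _).trans h1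
  · exact (abs_sub _ _).trans (by linarith)

variable [NeZero k]

lemma integrable_gradIntegrand (hσ : 0 < σ) (ν μ : P2 k) (x : Euc k) :
    Integrable (fun p : ℝ × Sph k => ((p.1 - transportMap σ μ ν p.2 p.1) *
      gaussianPDFReal 0 (sigmaSq σ) (p.1 - inner ℝ (p.2 : Euc k) x)) • (p.2 : Euc k))
      ((volume : Measure ℝ).prod (unif k)) := by
  have hv := sigmaSq_ne_zero hσ
  have hφ := continuous_gaussianPDFReal (sigmaSq σ)
  have hT := continuous_transportMap_swap hσ μ ν
  have h := (integrable_gaussMajorant hv (fieldConst σ ν (momentRadius μ)) ‖x‖).comp_fst (unif k)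
  refine h.mono' (Continuous.aestronglyMeasurable (by fun_prop)) (ae_of_all _ fun p => ?_)
  rw [norm_smul, norm_sph, mul_one]
  exact abs_mul_gaussianPDFReal_le hv (abs_sub_transportMap_le hσ ν (momentRadius_pos μ)
    (two_mul_integral_le μ) p.2 p.1) (abs_inner_sph_le p.2 x)

/-- Dominated convergence. `momentRadius μ` handles all measures within distance `1` of `μ`, and
`‖x‖ + 1` all points within distance `1` of `x`, so one majorant works for a whole neighbourhood. -/
theorem tendsto_gradField (hσ : 0 < σ) (ν μ : P2 k) (x : Euc k) :
    Tendsto (fun q : P2 k × Euc k => gradField σ ν q.1 q.2)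
      (comap (fun μ' => W2 μ' μ) (𝓝 0) ×ˢ 𝓝 x) (𝓝 (gradField σ ν μ x)) := by
  have hv := sigmaSq_ne_zero hσ
  have hφ := continuous_gaussianPDFReal (sigmaSq σ)
  have hW : Tendsto (fun q : P2 k × Euc k => W2 q.1 μ)
      (comap (fun μ' => W2 μ' μ) (𝓝 0) ×ˢ 𝓝 x) (𝓝 0) := 
    Tendsto.comp (g := fun μ' => W2 μ' μ) tendsto_comap tendsto_fst
  have hx : Tendsto (fun q : P2 k × Euc k => q.2)
      (comap (fun μ' => W2 μ' μ) (𝓝 0) ×ˢ 𝓝 x) (𝓝 x) := tendsto_snd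
  refine tendsto_integral_filter_of_dominated_convergence
    (fun p => gaussMajorant (sigmaSq σ) (fieldConst σ ν (momentRadius μ)) (‖x‖ + 1) p.1)
    (Eventually.of_forall fun q => ?_) ?_ ?_ (ae_of_all _ fun p => ?_)
  · have := continuous_transportMap_swap hσ q.1 ν
    exact Continuous.aestronglyMeasurable (by fun_prop)
  · filter_upwards [hW.eventually (gt_mem_nhds one_pos),
      hx.eventually (Metric.ball_mem_nhds x one_pos)] with q h1 h2
    refine ae_of_all _ fun p => ?_
    rw [norm_smul, norm_sph, mul_one]
    refine abs_mul_gaussianPDFReal_le hv (abs_sub_transportMap_le hσ ν (momentRadius_pos μ)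
      (two_mul_integral_le_of_W2_lt h1) p.2 p.1) ((abs_inner_sph_le p.2 q.2).trans ?_)
    have h3 : ‖q.2 - x‖ < 1 := by simpa [dist_eq_norm] using h2
    have := norm_add_le x (q.2 - x)
    rw [add_sub_cancel] at this
    linarith
  · exact (integrable_gaussMajorant hv _ _).comp_fst _
  · have h1 := tendsto_transportMap hσ ν hW (tendsto_const_nhds (x := p.2))
      (tendsto_const_nhds (x := p.1))
    have h2 : Tendsto (fun q : P2 k × Euc k =>
        gaussianPDFReal 0 (sigmaSq σ) (p.1 - inner ℝ (p.2 : Euc k) q.2))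
        (comap (fun μ' => W2 μ' μ) (𝓝 0) ×ˢ 𝓝 x)
        (𝓝 (gaussianPDFReal 0 (sigmaSq σ) (p.1 - inner ℝ (p.2 : Euc k) x))) :=
      ((by fun_prop : Continuous fun y : Euc k =>
        gaussianPDFReal 0 (sigmaSq σ) (p.1 - inner ℝ (p.2 : Euc k) y)).tendsto x).comp hx
    exact ((tendsto_const_nhds.sub h1).mul h2).smul_const _

theorem jointlyContinuous_gradField (hσ : 0 < σ) (ν : P2 k) :
    JointlyContinuous (gradField σ ν) := by
  intro μ x ε hε
  have h := (tendsto_gradField hσ ν μ x).eventually (Metric.ball_mem_nhds _ hε)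
  rw [((Metric.nhds_basis_ball.comap _).prod Metric.nhds_basis_ball).eventually_iff] at h
  obtain ⟨⟨a, b⟩, ⟨ha, hb⟩, h⟩ := h
  refine ⟨min a b, lt_min ha hb, fun μ' x' h1 h2 => ?_⟩
  have := h (x := (μ', x')) ⟨?_, ?_⟩
  · simpa [dist_eq_norm] using this
  · have : |W2 μ' μ| = W2 μ' μ := abs_of_nonneg (Real.sqrt_nonneg _)
    simpa [this] using h1.trans_le (min_le_left _ _)
  · simpa [dist_eq_norm] using h2.trans_le (min_le_right _ _)

lemma integrable_derivIntegrand (hσ : 0 < σ) (ν μ : P2 k) (x : Euc k) :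
    Integrable (derivIntegrand σ ν μ x) ((volume : Measure ℝ).prod (unif k)) := by
  have h := ((integrable_gaussMajorant_mul (sigmaSq_ne_zero hσ)
    (fieldConst σ ν (momentRadius μ)) ‖x‖ ‖x‖).div_const (sigmaSq σ : ℝ)).comp_fst (unif k)
  exact h.mono' (continuous_derivIntegrand hσ ν μ x).aestronglyMeasurable
    (ae_of_all _ fun p => norm_derivIntegrand_le hσ ν μ le_rfl p)

/-- Only the Gaussian density depends on `x`, so no derivative of the transport map is taken here.
-/
theorem hasFDerivAt_gradField (hσ : 0 < σ) (ν μ : P2 k) (x : Euc k) :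
    HasFDerivAt (gradField σ ν μ)
      (∫ p, derivIntegrand σ ν μ x p ∂((volume : Measure ℝ).prod (unif k))) x := by
  have hv := sigmaSq_ne_zero hσ
  have hφ := continuous_gaussianPDFReal (sigmaSq σ)
  have hT := continuous_transportMap_swap hσ μ ν
  have hball : ∀ y ∈ Metric.ball x 1, ‖y‖ ≤ ‖x‖ + 1 := fun y hy => by
    have h3 : ‖y - x‖ < 1 := by simpa [dist_eq_norm] using hy
    have := norm_add_le x (y - x)
    rw [add_sub_cancel] at this
    linarith
  have hcont : ∀ y : Euc k, Continuous fun p : ℝ × Sph k =>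
      ((p.1 - transportMap σ μ ν p.2 p.1) *
        gaussianPDFReal 0 (sigmaSq σ) (p.1 - inner ℝ (p.2 : Euc k) y)) • (p.2 : Euc k) :=
    fun y => by fun_prop
  refine hasFDerivAt_integral_of_dominated_of_fderiv_le (s := Metric.ball x 1)
    (F := fun y p => ((p.1 - transportMap σ μ ν p.2 p.1) *
      gaussianPDFReal 0 (sigmaSq σ) (p.1 - inner ℝ (p.2 : Euc k) y)) • (p.2 : Euc k))
    (bound := fun p => gaussMajorant (sigmaSq σ) (fieldConst σ ν (momentRadius μ)) (‖x‖ + 1) p.1 *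
        (|p.1| + (‖x‖ + 1)) / sigmaSq σ)
    (F' := derivIntegrand σ ν μ)
    (Metric.ball_mem_nhds x one_pos) (Eventually.of_forall fun y => (hcont y).aestronglyMeasurable)
    ?_ (continuous_derivIntegrand hσ ν μ x).aestronglyMeasurable
    (ae_of_all _ fun p y hy => norm_derivIntegrand_le hσ ν μ (hball y hy) p)
    ?_
    (ae_of_all _ fun p y hy => ?_)
  · exact integrable_gradIntegrand hσ ν μ x
  · exact ((integrable_gaussMajorant_mul hv (fieldConst σ ν (momentRadius μ)) (‖x‖ + 1)
      (‖x‖ + 1)).div_const (sigmaSq σ : ℝ)).comp_fst (unif k)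
  · have h1 : HasFDerivAt (fun y : Euc k => p.1 - inner ℝ (p.2 : Euc k) y)
        (-(innerSL ℝ (p.2 : Euc k))) y :=
      (innerSL ℝ (p.2 : Euc k)).hasFDerivAt.const_sub p.1
    have h2 := (hasDerivAt_gaussianPDFReal hv (p.1 - inner ℝ (p.2 : Euc k) y)).comp_hasFDerivAt y h1
    have h3 := (h2.const_mul (p.1 - transportMap σ μ ν p.2 p.1)).smul_const (p.2 : Euc k)
    refine h3.congr_fderiv ?_
    ext z
    simp [derivIntegrand, smul_smul]

end Field

/-! ### The Hessian -/

section Hessian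

variable {k : ℕ} {σ : ℝ}

lemma map_inner_add_gauss (θ : Sph k) (x : Euc k) :
    (gauss k σ).map (fun z => inner ℝ (θ : Euc k) (x + z)) =
      gaussianReal (inner ℝ (θ : Euc k) x) (sigmaSq σ) := by
  have : (fun z => inner ℝ (θ : Euc k) (x + z)) =
      (fun t => inner ℝ (θ : Euc k) x + t) ∘ fun z => inner ℝ (θ : Euc k) z := by
    ext z; simp [inner_add_right]
  rw [this, ← Measure.map_map (by fun_prop) (continuous_inner_sph θ).measurable]
  have h := slice_gauss (σ := σ) θ
  rw [slice] at h
  rw [h, gaussianReal_map_const_add, zero_add]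

lemma gaussianReal_eq_withDensity_sub (hσ : 0 < σ) (s : ℝ) :
    gaussianReal s (sigmaSq σ) = volume.withDensity fun t =>
      ENNReal.ofReal (gaussianPDFReal 0 (sigmaSq σ) (t - s)) := by
  rw [gaussianReal_of_var_ne_zero _ (sigmaSq_ne_zero hσ)]
  congr 1
  ext t
  rw [gaussianPDF, gaussianPDFReal_sub, zero_add]

/-- Dictionary between expectations over the noise and the density form in which `gradField` is
written. -/
lemma integral_comp_inner (hσ : 0 < σ) {f : ℝ → ℝ} (hf : Measurable f) (θ : Sph k) (x : Euc k) :
    ∫ z, f (inner ℝ (θ : Euc k) (x + z)) ∂(gauss k σ) =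
      ∫ t, f t * gaussianPDFReal 0 (sigmaSq σ) (t - inner ℝ (θ : Euc k) x) := by
  rw [← integral_map (φ := fun z => inner ℝ (θ : Euc k) (x + z)) (by fun_prop)
    hf.aestronglyMeasurable, map_inner_add_gauss,
    integral_gaussianReal_eq_integral_smul (sigmaSq_ne_zero hσ)]
  congr 1
  ext t
  rw [gaussianPDFReal_sub, zero_add, smul_eq_mul, mul_comm]

lemma integrable_comp_inner (hσ : 0 < σ) {f : ℝ → ℝ} (hf : Measurable f) {θ : Sph k} {x : Euc k}
    (hi : Integrable fun t => f t * gaussianPDFReal 0 (sigmaSq σ) (t - inner ℝ (θ : Euc k) x)) :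
    Integrable (fun z => f (inner ℝ (θ : Euc k) (x + z))) (gauss k σ) := by
  have hφ := continuous_gaussianPDFReal (sigmaSq σ)
  rw [← Function.comp_def f, ← integrable_map_measure hf.aestronglyMeasurable (by fun_prop),
    map_inner_add_gauss, gaussianReal_eq_withDensity_sub hσ,
    integrable_withDensity_iff (by fun_prop) (ae_of_all _ fun t => ENNReal.ofReal_lt_top)]
  simpa only [ENNReal.toReal_ofReal (gaussianPDFReal_nonneg _ _ _)] using hi

/-- Gaussian integration by parts for the transport map. -/
lemma transportMap_integration_by_parts (hσ : 0 < σ) (μ ν : P2 k) (θ : Sph k) (s : ℝ) :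
    Integrable (fun t => deriv (transportMap σ μ ν θ) t *
        gaussianPDFReal 0 (sigmaSq σ) (t - s)) ∧
      Integrable (fun t => transportMap σ μ ν θ t *
        ((t - s) / sigmaSq σ * gaussianPDFReal 0 (sigmaSq σ) (t - s))) ∧
      ∫ t, deriv (transportMap σ μ ν θ) t * gaussianPDFReal 0 (sigmaSq σ) (t - s) =
        ∫ t, transportMap σ μ ν θ t *
          ((t - s) / sigmaSq σ * gaussianPDFReal 0 (sigmaSq σ) (t - s)) :=
  integrable_deriv_mul_gaussianPDFReal (sigmaSq_ne_zero hσ) (differentiable_transportMap hσ μ ν θ)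
    (monotone_transportMap hσ μ ν θ)
    (abs_transportMap_le hσ ν (momentRadius_pos μ) (two_mul_integral_le μ) θ) s

/-- Integration by parts for the identity minus the one for the transport map. -/
lemma integral_one_sub_deriv_mul (hσ : 0 < σ) (μ ν : P2 k) (θ : Sph k) (s : ℝ) :
    Integrable (fun t => (1 - deriv (transportMap σ μ ν θ) t) *
        gaussianPDFReal 0 (sigmaSq σ) (t - s)) ∧
      ∫ t, (1 - deriv (transportMap σ μ ν θ) t) * gaussianPDFReal 0 (sigmaSq σ) (t - s) =
        ∫ t, (t - transportMap σ μ ν θ t) *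
          ((t - s) / sigmaSq σ * gaussianPDFReal 0 (sigmaSq σ) (t - s)) := by
  obtain ⟨a1, a2, a3⟩ := transportMap_integration_by_parts hσ μ ν θ s
  obtain ⟨b1, b2, b3⟩ := integrable_deriv_mul_gaussianPDFReal (g := id) (sigmaSq_ne_zero hσ)
    differentiable_id monotone_id (abs_le_mul_exp (sigmaSq_ne_zero hσ)) s
  simp only [deriv_id, id] at b1 b2 b3
  simp only [sub_mul]
  exact ⟨b1.sub a1, by rw [integral_sub b1 a1, integral_sub b2 a2, a3, b3]⟩

lemma measurable_deriv_transportMap (hσ : 0 < σ) (μ ν : P2 k) :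
    Measurable fun p : Sph k × ℝ => deriv (transportMap σ μ ν p.1) p.2 :=
  measurable_deriv_with_param (f := transportMap σ μ ν) (continuous_transportMap hσ μ ν)

lemma stronglyMeasurable_hessIntegrand (hσ : 0 < σ) (μ ν : P2 k) (x : Euc k) :
    StronglyMeasurable fun p : Euc k × Sph k => hessIntegrand σ μ ν x p.1 p.2 := by
  have h1 : Measurable fun p : Euc k × Sph k =>
      1 - deriv (transportMap σ μ ν p.2) (inner ℝ (p.2 : Euc k) (x + p.1)) :=
    measurable_const.sub ((measurable_deriv_transportMap hσ μ ν).comp (g := fun p : Sph k × ℝ =>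
      deriv (transportMap σ μ ν p.1) p.2) (f := fun p : Euc k × Sph k =>
        (p.2, inner ℝ (p.2 : Euc k) (x + p.1))) (by fun_prop))
  exact h1.stronglyMeasurable.smul
    (continuous_rankOne_sph.comp continuous_snd).stronglyMeasurable

lemma norm_hessIntegrand_le (hσ : 0 < σ) (μ ν : P2 k) (x z : Euc k) (θ : Sph k) :
    ‖hessIntegrand σ μ ν x z θ‖ ≤
      1 + deriv (transportMap σ μ ν θ) (inner ℝ (θ : Euc k) (x + z)) := by
  rw [hessIntegrand, norm_smul, InnerProductSpace.norm_rankOne, norm_sph, mul_one, mul_one]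
  have := (monotone_transportMap hσ μ ν θ).deriv_nonneg (x := inner ℝ (θ : Euc k) (x + z))
  refine (norm_sub_le _ _).trans ?_
  rw [norm_one, Real.norm_of_nonneg this]

lemma measurable_deriv_transportMap_apply (μ ν : P2 k) (θ : Sph k) :
    Measurable (deriv (transportMap σ μ ν θ)) := measurable_deriv _

lemma integrable_deriv_transportMap_inner (hσ : 0 < σ) (μ ν : P2 k) (x : Euc k) (θ : Sph k) :
    Integrable (fun z => deriv (transportMap σ μ ν θ) (inner ℝ (θ : Euc k) (x + z)))
      (gauss k σ) :=
  integrable_comp_inner hσ (measurable_deriv_transportMap_apply μ ν θ)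
    (transportMap_integration_by_parts hσ μ ν θ _).1

lemma integral_deriv_transportMap_inner (hσ : 0 < σ) (μ ν : P2 k) (x : Euc k) (θ : Sph k) :
    ∫ z, deriv (transportMap σ μ ν θ) (inner ℝ (θ : Euc k) (x + z)) ∂(gauss k σ) =
      ∫ t, transportMap σ μ ν θ t * ((t - inner ℝ (θ : Euc k) x) / sigmaSq σ *
        gaussianPDFReal 0 (sigmaSq σ) (t - inner ℝ (θ : Euc k) x)) := by
  rw [integral_comp_inner hσ (measurable_deriv_transportMap_apply μ ν θ),
    (transportMap_integration_by_parts hσ μ ν θ _).2.2]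

variable [NeZero k]

/-- No pointwise bound on `T_θ'` is at hand. Its Gaussian mean, however, is rewritten by parts in
terms of `T_θ` itself, which has a majorant independent of `θ`. -/
lemma integrable_hessIntegrand (hσ : 0 < σ) (μ ν : P2 k) (x : Euc k) :
    Integrable (fun p : Euc k × Sph k => hessIntegrand σ μ ν x p.1 p.2)
      ((gauss k σ).prod (unif k)) := by
  have hm := (stronglyMeasurable_hessIntegrand hσ μ ν x).aestronglyMeasurable
    (μ := (gauss k σ).prod (unif k))
  have hi : ∀ θ, Integrable (fun z =>
      1 + deriv (transportMap σ μ ν θ) (inner ℝ (θ : Euc k) (x + z))) (gauss k σ) := fun θ =>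
    (integrable_const 1).add (integrable_deriv_transportMap_inner hσ μ ν x θ)
  have hsec : ∀ θ, Integrable (fun z => hessIntegrand σ μ ν x z θ) (gauss k σ) := fun θ =>
    (hi θ).mono' ((stronglyMeasurable_hessIntegrand hσ μ ν x).comp_measurable
      (g := fun z => (z, θ)) (by fun_prop)).aestronglyMeasurable
      (ae_of_all _ fun z => norm_hessIntegrand_le hσ μ ν x z θ)
  rw [integrable_prod_iff' hm]
  refine ⟨ae_of_all _ hsec, ?_⟩
  set v := sigmaSq σ
  set K := growthConst v (∫ y, ‖y‖ ^ 2 ∂(reg σ ν.1)) (momentRadius μ)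
  refine Integrable.of_bound (C := 1 + ∫ t, gaussMajorant v K ‖x‖ t * (|t| + ‖x‖) / v)
    hm.norm.prod_swap.integral_prod_right' (ae_of_all _ fun θ => ?_)
  rw [Real.norm_of_nonneg (integral_nonneg fun z => norm_nonneg _)]
  refine (integral_mono (hsec θ).norm (hi θ)
    fun z => norm_hessIntegrand_le hσ μ ν x z θ).trans ?_
  rw [integral_add (integrable_const 1) (integrable_deriv_transportMap_inner hσ μ ν x θ),
    integral_deriv_transportMap_inner hσ]
  simp only [integral_const, probReal_univ, one_smul]
  refine add_le_add le_rfl ?_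
  refine integral_mono (transportMap_integration_by_parts hσ μ ν θ _).2.1
    ((integrable_gaussMajorant_mul (sigmaSq_ne_zero hσ) K ‖x‖ ‖x‖).div_const (v : ℝ)) fun t => ?_
  have hs := abs_inner_sph_le θ x
  have h1 := abs_mul_gaussianPDFReal_le (sigmaSq_ne_zero hσ) (abs_transportMap_le hσ ν
    (momentRadius_pos μ) (two_mul_integral_le μ) θ t) hs
  have e : ∀ a b c d : ℝ, a * (b / c * d) = (a * d) * b / c := fun a b c d => by ring
  simp only [e]
  refine div_le_div_of_nonneg_right ?_ v.coe_nonneg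
  refine (le_abs_self _).trans ?_
  rw [abs_mul]
  gcongr
  · exact (abs_nonneg _).trans h1
  · exact (abs_sub _ _).trans (by linarith)

theorem integral_derivIntegrand (hσ : 0 < σ) (ν μ : P2 k) (x : Euc k) :
    ∫ p, derivIntegrand σ ν μ x p ∂((volume : Measure ℝ).prod (unif k)) =
      ∫ z, ∫ θ, hessIntegrand σ μ ν x z θ ∂(unif k) ∂(gauss k σ) := by
  rw [integral_prod_symm _ (integrable_derivIntegrand hσ ν μ x),
    integral_integral_swap (f := fun z θ => hessIntegrand σ μ ν x z θ)
      (integrable_hessIntegrand hσ μ ν x)]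
  refine integral_congr_ae (ae_of_all _ fun θ => ?_)
  simp only [derivIntegrand, hessIntegrand]
  rw [integral_smul_const, integral_smul_const]
  congr 1
  rw [← (integral_one_sub_deriv_mul hσ μ ν θ _).2]
  exact (integral_comp_inner hσ (f := fun t => 1 - deriv (transportMap σ μ ν θ) t)
    (measurable_const.sub (measurable_deriv_transportMap_apply μ ν θ)) θ x).symm

theorem hasFDerivAt_gradField_hess (hσ : 0 < σ) (ν μ : P2 k) (x : Euc k) :
    HasFDerivAt (gradField σ ν μ)
      (∫ z, ∫ θ, hessIntegrand σ μ ν x z θ ∂(unif k) ∂(gauss k σ)) x :=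
  integral_derivIntegrand hσ ν μ x ▸ hasFDerivAt_gradField hσ ν μ x

end Hessian

/-! ### The law of the transported noise -/

section Transported

variable {k : ℕ} {σ : ℝ} {Ω : Type*} [MeasurableSpace Ω] {P : Measure Ω} [IsProbabilityMeasure P]
  {X : Ω → Euc k}

/-- The noise is carried by a second factor, so `Ω` need not support anything independent of `X`. -/
lemma map_inner_add_prod_gauss (hX : Measurable X) (θ : Sph k) :
    (P.prod (gauss k σ)).map (fun p => inner ℝ (θ : Euc k) (X p.1 + p.2)) =
      slice θ (reg σ (P.map X)) := by
  have h1 : (P.map X).prod (gauss k σ) = (P.prod (gauss k σ)).map (Prod.map X id) := by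
    conv_lhs => rw [← Measure.map_id (μ := gauss k σ)]
    exact Measure.map_prod_map P (gauss k σ) hX measurable_id
  rw [slice, reg, Measure.conv, h1, Measure.map_map (by fun_prop) (by fun_prop),
    Measure.map_map (by fun_prop) (by fun_prop)]
  rfl

lemma map_transportMap_slice (hσ : 0 < σ) (μ ν : P2 k) (θ : Sph k) :
    (slice θ (reg σ μ.1)).map (transportMap σ μ ν θ) = slice θ (reg σ ν.1) :=
  (regularCDF_slice_reg hσ θ μ.1).map_monoMap (regularCDF_slice_reg hσ θ ν.1)

/-- The resulting law does not depend on `X`. This makes the transported sample admissible in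
couplings for other vectors and fixes its `L²` norm. -/
lemma map_transportMap_inner (hσ : 0 < σ) {μ : P2 k} (ν : P2 k) (hX : Measurable X)
    (hμ : P.map X = μ.1) (θ : Sph k) :
    (P.prod (gauss k σ)).map
      (fun p => transportMap σ μ ν θ (inner ℝ (θ : Euc k) (X p.1 + p.2))) =
      slice θ (reg σ ν.1) := by
  rw [← map_transportMap_slice hσ μ ν θ, ← hμ, ← map_inner_add_prod_gauss hX,
    Measure.map_map (differentiable_transportMap hσ μ ν θ).continuous.measurable (by fun_prop)]
  rfl

lemma memLp_transportMap_inner (hσ : 0 < σ) {μ : P2 k} (ν : P2 k) (hX : Measurable X)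
    (hμ : P.map X = μ.1) (θ : Sph k) :
    MemLp (fun p => transportMap σ μ ν θ (inner ℝ (θ : Euc k) (X p.1 + p.2))) 2
      (P.prod (gauss k σ)) := by
  have hm : Measurable fun p : Ω × Euc k =>
      transportMap σ μ ν θ (inner ℝ (θ : Euc k) (X p.1 + p.2)) :=
    (differentiable_transportMap hσ μ ν θ).continuous.measurable.comp (by fun_prop)
  have h := memLp_id_slice (memLp_id_reg (σ := σ) ν.2.2) θ
  rw [← map_transportMap_inner hσ ν hX hμ θ, memLp_map_measure_iff aestronglyMeasurable_id
    hm.aemeasurable] at h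
  exact h

lemma integral_sq_transportMap_inner (hσ : 0 < σ) {μ : P2 k} (ν : P2 k) (hX : Measurable X)
    (hμ : P.map X = μ.1) (θ : Sph k) :
    ∫ p, (transportMap σ μ ν θ (inner ℝ (θ : Euc k) (X p.1 + p.2))) ^ 2 ∂(P.prod (gauss k σ)) =
      ∫ y, y ^ 2 ∂(slice θ (reg σ ν.1)) := by
  have hm : Measurable fun p : Ω × Euc k =>
      transportMap σ μ ν θ (inner ℝ (θ : Euc k) (X p.1 + p.2)) :=
    (differentiable_transportMap hσ μ ν θ).continuous.measurable.comp (by fun_prop)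
  rw [← map_transportMap_inner hσ ν hX hμ θ,
    integral_map hm.aemeasurable (by fun_prop)]

lemma integral_inner_sq_gauss (θ : Sph k) :
    ∫ z, (inner ℝ (θ : Euc k) z) ^ 2 ∂(gauss k σ) = σ ^ 2 := by
  have h1 : ∫ z, (inner ℝ (θ : Euc k) z) ^ 2 ∂(gauss k σ) =
      ∫ t, t ^ 2 ∂(slice θ (gauss k σ)) := by
    rw [slice, integral_map (continuous_inner_sph θ).measurable.aemeasurable (by fun_prop)]
  have h2 := variance_of_integral_eq_zero (μ := gaussianReal 0 (sigmaSq σ)) (X := fun t => t)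
    aemeasurable_id integral_id_gaussianReal
  rw [variance_fun_id_gaussianReal, coe_sigmaSq] at h2
  rw [h1, slice_gauss, h2]

end Transported

/-! ### The integral bound for the Hessian -/

lemma integral_mul_le_sqrt_mul_sqrt {α : Type*} [MeasurableSpace α] {Q : Measure α} {f g : α → ℝ}
    (hf : MemLp f 2 Q) (hg : MemLp g 2 Q) :
    ∫ a, f a * g a ∂Q ≤ √(∫ a, f a ^ 2 ∂Q) * √(∫ a, g a ^ 2 ∂Q) := by
  have h := integral_mul_norm_le_Lp_mul_Lq (μ := Q) (f := f) (g := g) Real.HolderConjugate.two_two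
    (by simpa using hf) (by simpa using hg)
  have h1 : ∫ a, f a * g a ∂Q ≤ ∫ a, ‖f a‖ * ‖g a‖ ∂Q :=
    integral_mono (MemLp.integrable_mul hf hg) (MemLp.integrable_mul hf.norm hg.norm) fun a => by
      simpa only [← norm_mul] using Real.le_norm_self _
  simpa [Real.sqrt_eq_rpow] using h1.trans h

section Bound

variable {k : ℕ} {σ : ℝ}

/-- Stein's identity turns the mean of `T_θ'` into that of `f * g`, where `g = θᵀN / σ²`. Then
Cauchy-Schwarz applies: `f²` has the mean of `y²` under the slice of the regularized `ν`, and `g²`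
has mean `1 / σ²`. -/
lemma lintegral_deriv_transportMap_le (hσ : 0 < σ) (μ ν : P2 k) (θ : Sph k) :
    ∫⁻ x, ∫⁻ z, ENNReal.ofReal (deriv (transportMap σ μ ν θ) (inner ℝ (θ : Euc k) (x + z)))
      ∂(gauss k σ) ∂μ.1 ≤ ENNReal.ofReal (1 / σ * √(∫ y, ‖y‖ ^ 2 ∂(reg σ ν.1))) := by
  have hT := (differentiable_transportMap hσ μ ν θ).continuous
  have hnn : ∀ t, 0 ≤ deriv (transportMap σ μ ν θ) t := fun t =>
    (monotone_transportMap hσ μ ν θ).deriv_nonneg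
  set f : Euc k × Euc k → ℝ := fun p => transportMap σ μ ν θ (inner ℝ (θ : Euc k) (p.1 + p.2))
  set g : Euc k × Euc k → ℝ := fun p => inner ℝ (θ : Euc k) p.2 / σ ^ 2
  have hJ : ∀ x, ∫ z, deriv (transportMap σ μ ν θ) (inner ℝ (θ : Euc k) (x + z)) ∂(gauss k σ) =
      ∫ z, f (x, z) * g (x, z) ∂(gauss k σ) := fun x => by
    have h := integral_comp_inner hσ (f := fun t => transportMap σ μ ν θ t *
      ((t - inner ℝ (θ : Euc k) x) / sigmaSq σ)) (by fun_prop) θ x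
    rw [integral_deriv_transportMap_inner hσ]
    simp only [mul_assoc] at h
    rw [← h]
    simp only [inner_add_right, add_sub_cancel_left, f, g, coe_sigmaSq]
  have hJ0 : ∀ x, 0 ≤ ∫ z, f (x, z) * g (x, z) ∂(gauss k σ) := fun x =>
    (integral_nonneg fun z => hnn _).trans_eq (hJ x)
  have hf : MemLp f 2 (μ.1.prod (gauss k σ)) :=
    memLp_transportMap_inner hσ ν measurable_id Measure.map_id θ
  have hg : MemLp g 2 (μ.1.prod (gauss k σ)) :=
    ((memLp_inner memLp_id_gauss θ).comp_measurePreserving measurePreserving_snd).mul_const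
      (σ ^ 2)⁻¹
  have hfg : Integrable (fun p => f p * g p) (μ.1.prod (gauss k σ)) := MemLp.integrable_mul hf hg
  have hf2 : ∫ p, f p ^ 2 ∂(μ.1.prod (gauss k σ)) ≤ ∫ y, ‖y‖ ^ 2 ∂(reg σ ν.1) := by
    refine (integral_sq_transportMap_inner hσ ν measurable_id Measure.map_id θ).trans_le ?_
    exact integral_sq_slice_le (memLp_id_reg ν.2.2) θ
  have hg2 : ∫ p, g p ^ 2 ∂(μ.1.prod (gauss k σ)) = (1 / σ) ^ 2 := by
    simp only [g, div_pow]
    rw [integral_div, integral_fun_snd (μ := μ.1) (ν := gauss k σ)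
      (f := fun z => (inner ℝ (θ : Euc k) z) ^ 2), integral_inner_sq_gauss]
    simp
    field_simp
  calc ∫⁻ x, ∫⁻ z, ENNReal.ofReal (deriv (transportMap σ μ ν θ) (inner ℝ (θ : Euc k) (x + z)))
      ∂(gauss k σ) ∂μ.1
      = ∫⁻ x, ENNReal.ofReal (∫ z, f (x, z) * g (x, z) ∂(gauss k σ)) ∂μ.1 := by
        refine lintegral_congr fun x => ?_
        rw [← hJ, ofReal_integral_eq_lintegral_ofReal
          (integrable_deriv_transportMap_inner hσ μ ν x θ) (ae_of_all _ fun z => hnn _)]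
    _ = ENNReal.ofReal (∫ x, ∫ z, f (x, z) * g (x, z) ∂(gauss k σ) ∂μ.1) := by
        rw [ofReal_integral_eq_lintegral_ofReal hfg.integral_prod_left
          (ae_of_all _ hJ0)]
    _ ≤ _ := by
        refine ENNReal.ofReal_le_ofReal ?_
        rw [← integral_prod _ hfg, mul_comm]
        refine (integral_mul_le_sqrt_mul_sqrt hf hg).trans ?_
        rw [hg2, Real.sqrt_sq (by positivity)]
        gcongr

/-- The operator norm of the integrand is at most `1 + T_θ'`. Tonelli brings the `θ` integral
outside, where the bound for a fixed direction applies; working in `ENNReal` yields integrability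
along with the estimate. -/
theorem lintegral_enorm_fderiv_gradField_le [NeZero k] (hσ : 0 < σ) (μ ν : P2 k) :
    ∫⁻ x, ‖fderiv ℝ (gradField σ ν μ) x‖ₑ ∂μ.1 ≤
      ENNReal.ofReal (1 + 1 / σ * √(∫ y, ‖y‖ ^ 2 ∂(reg σ ν.1))) := by
  set F : Euc k → Euc k → Sph k → ENNReal := fun x z θ =>
    ENNReal.ofReal (deriv (transportMap σ μ ν θ) (inner ℝ (θ : Euc k) (x + z))) with hF
  have hFm : Measurable fun q : (Euc k × Euc k) × Sph k => F q.1.1 q.1.2 q.2 :=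
    ENNReal.measurable_ofReal.comp ((measurable_deriv_transportMap hσ μ ν).comp
      (g := fun p : Sph k × ℝ => deriv (transportMap σ μ ν p.1) p.2)
      (f := fun q : (Euc k × Euc k) × Sph k => (q.2, inner ℝ (q.2 : Euc k) (q.1.1 + q.1.2)))
      (by fun_prop))
  have hpt : ∀ x, ‖fderiv ℝ (gradField σ ν μ) x‖ₑ ≤
      1 + ∫⁻ z, ∫⁻ θ, F x z θ ∂(unif k) ∂(gauss k σ) := fun x => by
    rw [(hasFDerivAt_gradField_hess hσ ν μ x).fderiv]
    have hin : ∀ z θ, ‖hessIntegrand σ μ ν x z θ‖ₑ ≤ 1 + F x z θ := fun z θ => by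
      rw [← ofReal_norm, ← ENNReal.ofReal_one, hF,
        ← ENNReal.ofReal_add zero_le_one (monotone_transportMap hσ μ ν θ).deriv_nonneg]
      exact ENNReal.ofReal_le_ofReal (norm_hessIntegrand_le hσ μ ν x z θ)
    calc ‖∫ z, ∫ θ, hessIntegrand σ μ ν x z θ ∂(unif k) ∂(gauss k σ)‖ₑ
        ≤ ∫⁻ z, ∫⁻ θ, ‖hessIntegrand σ μ ν x z θ‖ₑ ∂(unif k) ∂(gauss k σ) :=
          (enorm_integral_le_lintegral_enorm _).trans
            (lintegral_mono fun z => enorm_integral_le_lintegral_enorm _)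
      _ ≤ ∫⁻ z, ∫⁻ θ, (1 + F x z θ) ∂(unif k) ∂(gauss k σ) :=
          lintegral_mono fun z => lintegral_mono fun θ => hin z θ
      _ = _ := by
          simp only [lintegral_add_left measurable_const, lintegral_const, measure_univ, mul_one]
  have hswap : ∫⁻ x, ∫⁻ z, ∫⁻ θ, F x z θ ∂(unif k) ∂(gauss k σ) ∂μ.1 =
      ∫⁻ θ, ∫⁻ x, ∫⁻ z, F x z θ ∂(gauss k σ) ∂μ.1 ∂(unif k) := by
    have h1 : ∀ θ, Measurable fun p : Euc k × Euc k => F p.1 p.2 θ := fun θ =>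
      hFm.comp (f := fun p => (p, θ)) (by fun_prop)
    have h2 : Measurable fun p : Euc k × Euc k => ∫⁻ θ, F p.1 p.2 θ ∂(unif k) :=
      hFm.lintegral_prod_right'
    rw [← lintegral_prod (μ := μ.1) (ν := gauss k σ)
      (fun p : Euc k × Euc k => ∫⁻ θ, F p.1 p.2 θ ∂(unif k)) h2.aemeasurable,
      lintegral_lintegral_swap (f := fun (p : Euc k × Euc k) θ => F p.1 p.2 θ) hFm.aemeasurable]
    refine lintegral_congr fun θ => ?_
    exact lintegral_prod (μ := μ.1) (ν := gauss k σ) (fun p => F p.1 p.2 θ) (h1 θ).aemeasurable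
  calc ∫⁻ x, ‖fderiv ℝ (gradField σ ν μ) x‖ₑ ∂μ.1
      ≤ ∫⁻ x, (1 + ∫⁻ z, ∫⁻ θ, F x z θ ∂(unif k) ∂(gauss k σ)) ∂μ.1 := lintegral_mono hpt
    _ = 1 + ∫⁻ θ, ∫⁻ x, ∫⁻ z, F x z θ ∂(gauss k σ) ∂μ.1 ∂(unif k) := by
        rw [lintegral_add_left measurable_const, hswap]
        simp
    _ ≤ 1 + ∫⁻ _ : Sph k, ENNReal.ofReal (1 / σ * √(∫ y, ‖y‖ ^ 2 ∂(reg σ ν.1))) ∂(unif k) := by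
        gcongr with θ
        exact lintegral_deriv_transportMap_le hσ μ ν θ
    _ = _ := by
        rw [ENNReal.ofReal_add zero_le_one (by positivity)]
        simp

theorem integral_norm_fderiv_gradField_le [NeZero k] (hσ : 0 < σ) (μ ν : P2 k) :
    Integrable (fun x => ‖fderiv ℝ (gradField σ ν μ) x‖) μ.1 ∧
      ∫ x, ‖fderiv ℝ (gradField σ ν μ) x‖ ∂μ.1 ≤
        1 + 1 / σ * √(∫ y, ‖y‖ ^ 2 ∂(reg σ ν.1)) := by
  have h := lintegral_enorm_fderiv_gradField_le hσ μ ν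
  have hm : AEStronglyMeasurable (fderiv ℝ (gradField σ ν μ)) μ.1 :=
    (measurable_fderiv ℝ _).aestronglyMeasurable
  refine ⟨Integrable.norm ⟨hm, h.trans_lt ENNReal.ofReal_lt_top⟩, ?_⟩
  rw [integral_norm_eq_lintegral_enorm hm]
  exact ENNReal.toReal_le_of_le_ofReal (by positivity) h

end Bound

/-! ### Tools from `L²` -/

section Hilbert

variable {α : Type*} [MeasurableSpace α] {Q : Measure α}

lemma norm_sq_Lp {E : Type*} [NormedAddCommGroup E] [InnerProductSpace ℝ E] (f : Lp E 2 Q) :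
    ‖f‖ ^ 2 = ∫ a, ‖f a‖ ^ 2 ∂Q := by
  rw [← real_inner_self_eq_norm_sq, L2.inner_def]
  simp

lemma norm_sq_toLp {f : α → ℝ} (hf : MemLp f 2 Q) : ‖hf.toLp f‖ ^ 2 = ∫ a, f a ^ 2 ∂Q := by
  rw [norm_sq_Lp]
  refine integral_congr_ae ?_
  filter_upwards [hf.coeFn_toLp] with a ha
  rw [ha, Real.norm_eq_abs, sq_abs]

/-- Almost everywhere convergence together with constant `L²` norms implies convergence in `L²`. -/
lemma tendsto_integral_sq_sub [IsProbabilityMeasure Q] {f : ℕ → α → ℝ} {g : α → ℝ} {c : ℝ}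
    (hf : ∀ n, MemLp (f n) 2 Q) (hg : MemLp g 2 Q)
    (hfc : ∀ n, ∫ a, f n a ^ 2 ∂Q = c) (hgc : ∫ a, g a ^ 2 ∂Q = c)
    (hlim : ∀ᵐ a ∂Q, Tendsto (fun n => f n a) atTop (𝓝 (g a))) :
    Tendsto (fun n => ∫ a, (f n a - g a) ^ 2 ∂Q) atTop (𝓝 0) := by
  have hc : 0 ≤ c := hgc ▸ integral_nonneg fun a => sq_nonneg _
  -- Fatou is applied to `(f n + g)²`, whose integral is `4c` minus the quantity that should vanish,
  -- while its limit has integral `4c`. The added `1` keeps the comparison in `ENNReal` strict when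
  -- `c = 0`.
  have hsum : ∀ n, Integrable (fun a => (f n a + g a) ^ 2 + 1) Q := fun n =>
    ((hf n).add hg).integrable_sq.add (integrable_const 1)
  have hval : ∀ n, ∫ a, ((f n a + g a) ^ 2 + 1) ∂Q =
      4 * c + 1 - ∫ a, (f n a - g a) ^ 2 ∂Q := fun n => by
    have hi1 := (hf n).integrable_sq
    have hi2 := hg.integrable_sq
    have hi3 : Integrable (fun a => (f n a - g a) ^ 2) Q := ((hf n).sub hg).integrable_sq
    have : (fun a => (f n a + g a) ^ 2 + 1) =
        fun a => (2 * f n a ^ 2 + 2 * g a ^ 2) + 1 - (f n a - g a) ^ 2 := by ext a; ring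
    have j1 : Integrable (fun a => 2 * f n a ^ 2 + 2 * g a ^ 2) Q :=
      (hi1.const_mul 2).add (hi2.const_mul 2)
    have j2 : Integrable (fun a => 2 * f n a ^ 2 + 2 * g a ^ 2 + 1) Q :=
      j1.add (integrable_const 1)
    rw [this, integral_sub j2 hi3, integral_add j1 (integrable_const 1),
      integral_add (hi1.const_mul 2) (hi2.const_mul 2), integral_const_mul, integral_const_mul,
      hfc, hgc]
    simp only [integral_const, probReal_univ, one_smul]
    ring
  have hfatou : ENNReal.ofReal (4 * c + 1) ≤
      liminf (fun n => ENNReal.ofReal (4 * c + 1 - ∫ a, (f n a - g a) ^ 2 ∂Q)) atTop := by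
    have h1 : ENNReal.ofReal (4 * c + 1) = ∫⁻ a, ENNReal.ofReal (4 * g a ^ 2 + 1) ∂Q := by
      have hi : Integrable (fun a => 4 * g a ^ 2 + 1) Q :=
        (hg.integrable_sq.const_mul 4).add (integrable_const 1)
      rw [← ofReal_integral_eq_lintegral_ofReal hi (ae_of_all _ fun a => by positivity),
        integral_add (hg.integrable_sq.const_mul 4) (integrable_const 1), integral_const_mul, hgc]
      simp
    have h2 : ∫⁻ a, ENNReal.ofReal (4 * g a ^ 2 + 1) ∂Q =
        ∫⁻ a, liminf (fun n => ENNReal.ofReal ((f n a + g a) ^ 2 + 1)) atTop ∂Q := by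
      refine lintegral_congr_ae ?_
      filter_upwards [hlim] with a ha
      have h3 : Tendsto (fun n => ENNReal.ofReal ((f n a + g a) ^ 2 + 1)) atTop
          (𝓝 (ENNReal.ofReal (4 * g a ^ 2 + 1))) := by
        refine (ENNReal.continuous_ofReal.tendsto _).comp ?_
        have := ((ha.add_const (g a)).pow 2).add_const 1
        convert this using 2
        ring
      exact h3.liminf_eq.symm
    rw [h1, h2]
    refine (lintegral_liminf_le' fun n => (hsum n).aemeasurable.ennreal_ofReal).trans_eq ?_
    congr 1
    ext n
    rw [← hval, ofReal_integral_eq_lintegral_ofReal (hsum n) (ae_of_all _ fun a => by positivity)]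
  refine tendsto_order.2 ⟨fun b hb => Eventually.of_forall fun n =>
    hb.trans_le (integral_nonneg fun a => sq_nonneg _), fun ε hε => ?_⟩
  have hlt : ENNReal.ofReal (4 * c + 1 - ε) < ENNReal.ofReal (4 * c + 1) :=
    (ENNReal.ofReal_lt_ofReal_iff (by linarith)).2 (by linarith)
  filter_upwards [eventually_lt_of_lt_liminf (hlt.trans_le hfatou)] with n hn
  have := lt_of_not_ge fun h => hn.not_ge (ENNReal.ofReal_le_ofReal h)
  linarith

/-- A criterion for differentiability of a function `w = ‖A ·‖² / 2` that lies below the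
quadratic functions `Y ↦ ‖A X + S (Y - X)‖² / 2`. -/
lemma hasGradientAt_of_half_norm_sq {H K : Type*} [NormedAddCommGroup H] [InnerProductSpace ℝ H]
    [CompleteSpace H] [NormedAddCommGroup K] [InnerProductSpace ℝ K] {A S : H → K} {w : H → ℝ}
    {X g : H} (hA : ContinuousAt A X) (hS : ∀ h, ‖S h‖ ≤ ‖h‖) (hw : ∀ Y, w Y = ‖A Y‖ ^ 2 / 2)
    (hle : ∀ Y Z, w Z ≤ ‖A Y + S (Z - Y)‖ ^ 2 / 2) (hg : ∀ h, ⟪A X, S h⟫ = ⟪g, h⟫) :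
    HasGradientAt w g X := by
  rw [hasGradientAt_iff_isLittleO, Asymptotics.isLittleO_iff]
  intro c hc
  have h1 : ∀ᶠ Y in 𝓝 X, ‖A Y - A X‖ < c / 2 := by
    have := Metric.tendsto_nhds.1 hA (c / 2) (by positivity)
    simpa only [dist_eq_norm] using this
  have h2 : ∀ᶠ Y in 𝓝 X, ‖Y - X‖ < c := by
    filter_upwards [Metric.ball_mem_nhds X hc] with Y hY
    rwa [← dist_eq_norm]
  filter_upwards [h1, h2] with Y hY1 hY2
  have key : ∀ (a s : K), ‖a + s‖ ^ 2 / 2 = ‖a‖ ^ 2 / 2 + ⟪a, s⟫ + ‖s‖ ^ 2 / 2 := fun a s => by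
    rw [norm_add_sq_real]; ring
  have hs : ∀ h, ‖S h‖ ^ 2 ≤ ‖h‖ ^ 2 := fun h => pow_le_pow_left₀ (norm_nonneg _) (hS h) 2
  -- Expanding at `X` bounds the increment from above with error `‖Y - X‖² / 2`. Expanding at `Y`
  -- bounds it from below with the further error `‖A Y - A X‖ * ‖Y - X‖`, where continuity of `A`
  -- enters. Each error is at most `c / 2 * ‖Y - X‖`.
  have up := hle X Y
  have lo := hle Y X
  rw [key, hg, ← hw X] at up
  rw [key, ← hw Y] at lo
  have e1 : ⟪g, Y - X⟫ = -⟪A X, S (X - Y)⟫ := by rw [hg, ← inner_neg_right, neg_sub]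
  have e2 : ⟪A Y, S (X - Y)⟫ = ⟪A Y - A X, S (X - Y)⟫ + ⟪A X, S (X - Y)⟫ := by
    rw [inner_sub_left]; ring
  have e3 : ⟪A Y - A X, S (X - Y)⟫ ≤ ‖A Y - A X‖ * ‖X - Y‖ :=
    (real_inner_le_norm _ _).trans (mul_le_mul_of_nonneg_left (hS _) (norm_nonneg _))
  have s1 := hs (Y - X)
  have s2 := hs (X - Y)
  rw [norm_sub_rev X Y] at e3 s2
  have n0 := norm_nonneg (Y - X)
  have p1 : ‖A Y - A X‖ * ‖Y - X‖ ≤ c / 2 * ‖Y - X‖ := by gcongr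
  have p2 : ‖Y - X‖ ^ 2 ≤ c * ‖Y - X‖ := by rw [sq]; gcongr
  rw [Real.norm_eq_abs, abs_le]
  constructor <;> nlinarith

end Hilbert

/-! ### The lift to `L²` -/

section Lift

variable {k : ℕ} {σ : ℝ} {Ω : Type*} [MeasurableSpace Ω] {P : Measure Ω}

lemma measurable_Lp (X : Lp (Euc k) 2 P) : Measurable X := (Lp.stronglyMeasurable X).measurable

lemma memLp_inner_prod_unif [IsFiniteMeasure (unif k)] {β : Type*} [MeasurableSpace β]
    {R : Measure β} [SFinite R] {f : β → Euc k} (hf : MemLp f 2 R) :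
    MemLp (fun q : β × Sph k => inner ℝ (q.2 : Euc k) (f q.1)) 2 (R.prod (unif k)) := by
  have h := hf.comp_fst (unif k)
  have hc : Continuous fun θ : Sph k => (θ : Euc k) := continuous_subtype_val
  refine h.mono ((hc.comp_aestronglyMeasurable
    aestronglyMeasurable_id.comp_snd).inner h.aestronglyMeasurable) (ae_of_all _ fun q => ?_)
  exact abs_inner_sph_le q.2 (f q.1)

lemma ae_of_ae_fst_fst {p : Ω → Prop} (h : ∀ᵐ ω ∂P, p ω) :
    ∀ᵐ q ∂((P.prod (gauss k σ)).prod (unif k)), p q.1.1 :=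
  (Measure.quasiMeasurePreserving_fst.comp Measure.quasiMeasurePreserving_fst).ae h

variable [IsProbabilityMeasure P]

/-- The sample `T_θ(θᵀ(X + N))` of the slice of the regularization of `ν`. -/
noncomputable def transported (σ : ℝ) (ν : P2 k) (X : Lp (Euc k) 2 P)
    (q : (Ω × Euc k) × Sph k) : ℝ :=
  transportMap σ (law P X) ν q.2 (inner ℝ (q.2 : Euc k) (X q.1.1 + q.1.2))

/-- The difference `θᵀ(Y + N) - T_θ(θᵀ(X + N))`, where `T_θ` is taken at the law of `X`. -/
noncomputable def gap (σ : ℝ) (ν : P2 k) (X Y : Lp (Euc k) 2 P)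
    (q : (Ω × Euc k) × Sph k) : ℝ :=
  inner ℝ (q.2 : Euc k) (Y q.1.1) + inner ℝ (q.2 : Euc k) q.1.2 - transported σ ν X q

lemma measurable_transported (hσ : 0 < σ) (ν : P2 k) (X : Lp (Euc k) 2 P) :
    Measurable (transported σ ν X) := by
  have hX := measurable_Lp X
  exact (continuous_transportMap hσ (law P X) ν).measurable.comp
    (g := fun p : Sph k × ℝ => transportMap σ (law P X) ν p.1 p.2)
    (f := fun q : (Ω × Euc k) × Sph k => (q.2, inner ℝ (q.2 : Euc k) (X q.1.1 + q.1.2)))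
    (by fun_prop)

lemma W2_law_le (X Y : Lp (Euc k) 2 P) : W2 (law P Y) (law P X) ≤ ‖Y - X‖ := by
  have h : W2sq (P.map Y) (P.map X) ≤ ∫ ω, ‖Y ω - X ω‖ ^ 2 / 2 ∂P :=
    W2sq_map_le (Lp.memLp Y) (Lp.memLp X)
  have h2 : ∫ ω, ‖Y ω - X ω‖ ^ 2 / 2 ∂P = ‖Y - X‖ ^ 2 / 2 := by
    rw [integral_div, norm_sq_Lp]
    congr 1
    refine integral_congr_ae ?_
    filter_upwards [Lp.coeFn_sub Y X] with ω hω
    rw [hω, Pi.sub_apply]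
  refine Real.sqrt_le_iff.2 ⟨norm_nonneg _, ?_⟩
  have h3 : W2sq (law P Y).1 (law P X).1 ≤ ‖Y - X‖ ^ 2 / 2 := h2 ▸ h
  nlinarith [sq_nonneg ‖Y - X‖]

lemma memLp_transported_section (hσ : 0 < σ) (ν : P2 k) (X : Lp (Euc k) 2 P) (θ : Sph k) :
    MemLp (fun p => transported σ ν X (p, θ)) 2 (P.prod (gauss k σ)) :=
  memLp_transportMap_inner hσ ν (measurable_Lp X) rfl θ

lemma integral_sq_transported_section (hσ : 0 < σ) (ν : P2 k) (X : Lp (Euc k) 2 P) (θ : Sph k) :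
    ∫ p, transported σ ν X (p, θ) ^ 2 ∂(P.prod (gauss k σ)) =
      ∫ y, y ^ 2 ∂(slice θ (reg σ ν.1)) :=
  integral_sq_transportMap_inner hσ ν (measurable_Lp X) rfl θ

/-- The map belonging to `X` is suboptimal for `Y`, but its sample still has the slice of the
regularized `ν` as law, so the pairing is a coupling. -/
lemma W2sq_slice_law_le (hσ : 0 < σ) (ν : P2 k) (X Y : Lp (Euc k) 2 P) (θ : Sph k) :
    W2sq (slice θ (reg σ (law P Y).1)) (slice θ (reg σ ν.1)) ≤
      ∫ p, gap σ ν X Y (p, θ) ^ 2 / 2 ∂(P.prod (gauss k σ)) := by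
  have h1 : MemLp (fun p : Ω × Euc k => inner ℝ (θ : Euc k) (Y p.1 + p.2)) 2
      (P.prod (gauss k σ)) := by
    have h1 : MemLp (fun p : Ω × Euc k => Y p.1 + p.2) 2 (P.prod (gauss k σ)) :=
      ((Lp.memLp Y).comp_fst (gauss k σ)).add
        (memLp_id_gauss.comp_measurePreserving measurePreserving_snd)
    exact h1.const_inner (θ : Euc k)
  have h := W2sq_map_le h1 (memLp_transported_section hσ ν X θ)
  have h2 : (P.prod (gauss k σ)).map (fun p => transported σ ν X (p, θ)) = slice θ (reg σ ν.1) :=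
    map_transportMap_inner hσ ν (measurable_Lp X) rfl θ
  rw [map_inner_add_prod_gauss (measurable_Lp Y), h2] at h
  simp only [inner_add_right, Real.norm_eq_abs, sq_abs] at h
  exact h

/-- On the diagonal the pairing is the monotone rearrangement, which is optimal. -/
lemma W2sq_slice_law_eq (hσ : 0 < σ) (ν : P2 k) (Y : Lp (Euc k) 2 P) (θ : Sph k) :
    W2sq (slice θ (reg σ (law P Y).1)) (slice θ (reg σ ν.1)) =
      ∫ p, gap σ ν Y Y (p, θ) ^ 2 / 2 ∂(P.prod (gauss k σ)) := by
  have hm : Measurable fun p : Ω × Euc k => inner ℝ (θ : Euc k) (Y p.1 + p.2) := by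
    have := measurable_Lp Y
    fun_prop
  have hT := (differentiable_transportMap hσ (law P Y) ν θ).continuous
  rw [(regularCDF_slice_reg hσ θ (law P Y).1).W2sq_eq (regularCDF_slice_reg hσ θ ν.1)
    (memLp_id_slice (memLp_id_reg (law P Y).2.2) θ) (memLp_id_slice (memLp_id_reg ν.2.2) θ),
    ← transportMap_eq]
  have h : slice θ (reg σ (law P Y).1) = (P.prod (gauss k σ)).map
      (fun p => inner ℝ (θ : Euc k) (Y p.1 + p.2)) :=
    (map_inner_add_prod_gauss (measurable_Lp Y) θ).symm
  rw [h, integral_map hm.aemeasurable (by fun_prop)]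
  refine integral_congr_ae (ae_of_all _ fun p => ?_)
  simp only [gap, transported, inner_add_right]

variable [NeZero k]

lemma memLp_transported (hσ : 0 < σ) (ν : P2 k) (X : Lp (Euc k) 2 P) :
    MemLp (transported σ ν X) 2 ((P.prod (gauss k σ)).prod (unif k)) := by
  have hm := measurable_transported hσ ν X
  rw [memLp_two_iff_integrable_sq hm.aestronglyMeasurable,
    integrable_prod_iff' (hm.pow_const 2).aestronglyMeasurable]
  refine ⟨ae_of_all _ fun θ => (memLp_transported_section hσ ν X θ).integrable_sq, ?_⟩
  refine Integrable.of_bound (C := ∫ y, ‖y‖ ^ 2 ∂(reg σ ν.1))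
    (hm.pow_const 2).aestronglyMeasurable.norm.prod_swap.integral_prod_right'
    (ae_of_all _ fun θ => ?_)
  rw [Real.norm_of_nonneg (integral_nonneg fun z => norm_nonneg _)]
  simp only [norm_pow, Real.norm_eq_abs, sq_abs]
  rw [integral_sq_transported_section hσ]
  exact integral_sq_slice_le (memLp_id_reg ν.2.2) θ

lemma integral_sq_transported (hσ : 0 < σ) (ν : P2 k) (X : Lp (Euc k) 2 P) :
    ∫ q, transported σ ν X q ^ 2 ∂((P.prod (gauss k σ)).prod (unif k)) =
      ∫ θ, ∫ y, y ^ 2 ∂(slice θ (reg σ ν.1)) ∂(unif k) := by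
  rw [integral_prod_symm _ (memLp_transported hσ ν X).integrable_sq]
  simp only [integral_sq_transported_section hσ]

lemma memLp_inner_Lp (σ : ℝ) (Y : Lp (Euc k) 2 P) :
    MemLp (fun q : (Ω × Euc k) × Sph k => inner ℝ (q.2 : Euc k) (Y q.1.1)) 2
      ((P.prod (gauss k σ)).prod (unif k)) :=
  memLp_inner_prod_unif (f := fun p : Ω × Euc k => Y p.1) ((Lp.memLp Y).comp_fst (gauss k σ))

lemma memLp_gap (hσ : 0 < σ) (ν : P2 k) (X Y : Lp (Euc k) 2 P) :
    MemLp (gap σ ν X Y) 2 ((P.prod (gauss k σ)).prod (unif k)) := by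
  have h2 : MemLp (fun q : (Ω × Euc k) × Sph k => inner ℝ (q.2 : Euc k) q.1.2) 2
      ((P.prod (gauss k σ)).prod (unif k)) :=
    memLp_inner_prod_unif (f := fun p : Ω × Euc k => p.2)
      (memLp_id_gauss.comp_measurePreserving measurePreserving_snd)
  exact ((memLp_inner_Lp σ Y).add h2).sub (memLp_transported hσ ν X)

lemma SW2regSq_law_eq (hσ : 0 < σ) (ν : P2 k) (Y : Lp (Euc k) 2 P) :
    SW2regSq σ (law P Y) ν =
      (∫ q, gap σ ν Y Y q ^ 2 ∂((P.prod (gauss k σ)).prod (unif k))) / 2 := by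
  rw [← integral_div, integral_prod_symm _ ((memLp_gap hσ ν Y Y).integrable_sq.div_const 2),
    SW2regSq, SW2sq]
  simp only [W2sq_slice_law_eq hσ]

lemma SW2regSq_law_le (hσ : 0 < σ) (ν : P2 k) (X Y : Lp (Euc k) 2 P) :
    SW2regSq σ (law P Y) ν ≤
      (∫ q, gap σ ν X Y q ^ 2 ∂((P.prod (gauss k σ)).prod (unif k))) / 2 := by
  have hX := (memLp_gap hσ ν X Y).integrable_sq.div_const 2
  have hY := (memLp_gap hσ ν Y Y).integrable_sq.div_const 2
  rw [← integral_div, integral_prod_symm _ hX, SW2regSq, SW2sq]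
  refine integral_mono ?_ hX.integral_prod_right fun θ => W2sq_slice_law_le hσ ν X Y θ
  simpa only [W2sq_slice_law_eq hσ] using hY.integral_prod_right

/-- The function `θᵀ Y` as an element of `L²`. -/
noncomputable def sliceLp (σ : ℝ) (Y : Lp (Euc k) 2 P) :
    Lp ℝ 2 ((P.prod (gauss k σ)).prod (unif k)) := (memLp_inner_Lp σ Y).toLp _

lemma norm_sliceLp_le (Y : Lp (Euc k) 2 P) : ‖sliceLp σ Y‖ ≤ ‖Y‖ := by
  refine le_of_sq_le_sq ?_ (norm_nonneg _)
  rw [sliceLp, norm_sq_toLp, norm_sq_Lp]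
  have hi : Integrable (fun ω => ‖Y ω‖ ^ 2) P := (Lp.memLp Y).integrable_norm_pow two_ne_zero
  have h1 : ∫ q : (Ω × Euc k) × Sph k, ‖Y q.1.1‖ ^ 2 ∂((P.prod (gauss k σ)).prod (unif k)) =
      ∫ ω, ‖Y ω‖ ^ 2 ∂P := by
    rw [integral_fun_fst (f := fun p : Ω × Euc k => ‖Y p.1‖ ^ 2),
      integral_fun_fst (f := fun ω => ‖Y ω‖ ^ 2)]
    simp
  rw [← h1]
  refine integral_mono (memLp_inner_Lp σ Y).integrable_sq
    ((hi.comp_fst (gauss k σ)).comp_fst (unif k)) fun q => ?_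
  simpa only [sq_abs] using pow_le_pow_left₀ (abs_nonneg _) (abs_inner_sph_le q.2 (Y q.1.1)) 2

/-- The function `gap` as an element of `L²`. -/
noncomputable def gapLp (hσ : 0 < σ) (ν : P2 k) (X Y : Lp (Euc k) 2 P) :
    Lp ℝ 2 ((P.prod (gauss k σ)).prod (unif k)) := (memLp_gap hσ ν X Y).toLp _

/-- With the transported sample frozen, the gap is affine in `Y`. -/
lemma gapLp_eq_add (hσ : 0 < σ) (ν : P2 k) (X Y : Lp (Euc k) 2 P) :
    gapLp hσ ν X Y = gapLp hσ ν X X + sliceLp σ (Y - X) := by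
  rw [gapLp, gapLp, sliceLp, ← MemLp.toLp_add]
  refine MemLp.toLp_congr _ _ ?_
  filter_upwards [ae_of_ae_fst_fst (Lp.coeFn_sub Y X)] with q hq
  simp only [Pi.add_apply, gap, hq, Pi.sub_apply, inner_sub_right]
  ring

/-- Along a subsequence `Y → X` almost everywhere and the laws converge in `W2`, so stability of the
maps gives almost everywhere convergence. The `L²` norms are constant, which upgrades it to `L²`
convergence. -/
lemma tendsto_transported_toLp (hσ : 0 < σ) (ν : P2 k) (X : Lp (Euc k) 2 P) :
    Tendsto (fun Y => (memLp_transported hσ ν Y).toLp (transported σ ν Y)) (𝓝 X)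
      (𝓝 ((memLp_transported hσ ν X).toLp (transported σ ν X))) := by
  refine tendsto_of_subseq_tendsto fun Ys hYs => ?_
  obtain ⟨ms, hms, hae⟩ :=
    (tendstoInMeasure_of_tendsto_Lp (f := Ys) (g := X) hYs).exists_seq_tendsto_ae
  refine ⟨ms, ?_⟩
  have hYm : Tendsto (fun n => Ys (ms n)) atTop (𝓝 X) := hYs.comp hms.tendsto_atTop
  have hW : Tendsto (fun n => W2 (law P (Ys (ms n))) (law P X)) atTop (𝓝 0) :=
    squeeze_zero (fun n => Real.sqrt_nonneg _) (fun n => W2_law_le X (Ys (ms n)))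
      (tendsto_iff_norm_sub_tendsto_zero.1 hYm)
  have hlim : ∀ᵐ q ∂((P.prod (gauss k σ)).prod (unif k)),
      Tendsto (fun n => transported σ ν (Ys (ms n)) q) atTop (𝓝 (transported σ ν X q)) := by
    filter_upwards [ae_of_ae_fst_fst hae] with q hq
    exact tendsto_transportMap hσ ν hW tendsto_const_nhds
      (tendsto_const_nhds.inner (hq.add tendsto_const_nhds))
  have h := tendsto_integral_sq_sub (fun n => memLp_transported hσ ν (Ys (ms n)))
    (memLp_transported hσ ν X) (fun n => integral_sq_transported hσ ν (Ys (ms n)))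
    (integral_sq_transported hσ ν X) hlim
  rw [tendsto_iff_norm_sub_tendsto_zero]
  have h2 := h.sqrt
  rw [Real.sqrt_zero] at h2
  refine h2.congr fun n => ?_
  rw [← MemLp.toLp_sub, ← Real.sqrt_sq (norm_nonneg _), norm_sq_toLp]
  rfl

lemma continuousAt_gapLp (hσ : 0 < σ) (ν : P2 k) (X : Lp (Euc k) 2 P) :
    ContinuousAt (fun Y => gapLp hσ ν Y Y) X := by
  have hsub : ∀ Y, gapLp hσ ν Y Y = gapLp hσ ν X X + sliceLp σ (Y - X) -
      ((memLp_transported hσ ν Y).toLp (transported σ ν Y) -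
        (memLp_transported hσ ν X).toLp (transported σ ν X)) := fun Y => by
    rw [← gapLp_eq_add, gapLp, gapLp, ← MemLp.toLp_sub, ← MemLp.toLp_sub]
    refine MemLp.toLp_congr _ _ (ae_of_all _ fun q => ?_)
    simp only [Pi.sub_apply, gap]
    ring
  have h1 : Tendsto (fun Y => sliceLp σ (Y - X)) (𝓝 X) (𝓝 0) :=
    squeeze_zero_norm (fun Y => norm_sliceLp_le (Y - X))
      (tendsto_iff_norm_sub_tendsto_zero.1 tendsto_id)
  have h2 := (h1.const_add (gapLp hσ ν X X)).sub
    ((tendsto_transported_toLp hσ ν X).sub_const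
      ((memLp_transported hσ ν X).toLp (transported σ ν X)))
  rw [ContinuousAt]
  simpa only [← hsub, add_zero, sub_self, sub_zero] using h2

end Lift

/-! ### The `L`-derivative -/

section LDerivative

lemma integral_prod_of_integrable_assoc {α β γ : Type*} [MeasurableSpace α] [MeasurableSpace β]
    [MeasurableSpace γ] (μ₁ : Measure α) (μ₂ : Measure β) (μ₃ : Measure γ) [SFinite μ₁]
    [SFinite μ₂] [SFinite μ₃] {f : (α × β) × γ → ℝ} (hf : Integrable f ((μ₁.prod μ₂).prod μ₃)) :
    ∫ q, f q ∂((μ₁.prod μ₂).prod μ₃) =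
      ∫ a, ∫ r, f ((a, r.1), r.2) ∂(μ₂.prod μ₃) ∂μ₁ := by
  have hmp := (measurePreserving_prodAssoc μ₁ μ₂ μ₃).symm
  rw [← hmp.integral_comp' f]
  exact integral_prod _ (hmp.integrable_comp_of_integrable hf)

lemma integrable_smul_sph {k : ℕ} {σ : ℝ} {f : Euc k × Sph k → ℝ}
    (hf : Integrable f ((gauss k σ).prod (unif k))) :
    Integrable (fun r => f r • (r.2 : Euc k)) ((gauss k σ).prod (unif k)) := by
  have hc : Continuous fun r : Euc k × Sph k => (r.2 : Euc k) := by fun_prop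
  refine hf.mono (hf.aestronglyMeasurable.smul hc.aestronglyMeasurable) (ae_of_all _ fun r => ?_)
  rw [norm_smul, norm_sph, mul_one]

variable {k : ℕ} {σ : ℝ} {Ω : Type*} [MeasurableSpace Ω] {P : Measure Ω}
  [IsProbabilityMeasure P]

lemma gap_self_apply (ν : P2 k) (X : Lp (Euc k) 2 P) (ω : Ω) (z : Euc k) (θ : Sph k) :
    gap σ ν X X ((ω, z), θ) = inner ℝ (θ : Euc k) (X ω + z) -
      transportMap σ (law P X) ν θ (inner ℝ (θ : Euc k) (X ω + z)) := by
  rw [gap, transported, inner_add_right]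

variable [NeZero k]

lemma integrable_inner_sub_transportMap (hσ : 0 < σ) (ν μ : P2 k) (x : Euc k) :
    Integrable (fun r : Euc k × Sph k => inner ℝ (r.2 : Euc k) (x + r.1) -
      transportMap σ μ ν r.2 (inner ℝ (r.2 : Euc k) (x + r.1))) ((gauss k σ).prod (unif k)) := by
  have hv := sigmaSq_ne_zero hσ
  have hφ := continuous_gaussianPDFReal (sigmaSq σ)
  set K := fieldConst σ ν (momentRadius μ)
  have hTc : Continuous fun r : Euc k × Sph k =>
      transportMap σ μ ν r.2 (inner ℝ (r.2 : Euc k) (x + r.1)) :=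
    (continuous_transportMap hσ μ ν).comp (g := fun p : Sph k × ℝ => transportMap σ μ ν p.1 p.2)
      (f := fun r : Euc k × Sph k => (r.2, inner ℝ (r.2 : Euc k) (x + r.1))) (by fun_prop)
  have hm : AEStronglyMeasurable (fun r : Euc k × Sph k => inner ℝ (r.2 : Euc k) (x + r.1) -
      transportMap σ μ ν r.2 (inner ℝ (r.2 : Euc k) (x + r.1))) ((gauss k σ).prod (unif k)) :=
    Continuous.aestronglyMeasurable (by fun_prop)
  have hT : ∀ θ, Continuous (transportMap σ μ ν θ) := fun θ =>
    (differentiable_transportMap hσ μ ν θ).continuous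
  have hbd : ∀ (θ : Sph k) (t : ℝ), |(t - transportMap σ μ ν θ t) *
      gaussianPDFReal 0 (sigmaSq σ) (t - inner ℝ (θ : Euc k) x)| ≤
        gaussMajorant (sigmaSq σ) K ‖x‖ t := fun θ t =>
    abs_mul_gaussianPDFReal_le hv (abs_sub_transportMap_le hσ ν (momentRadius_pos μ)
      (two_mul_integral_le μ) θ t) (abs_inner_sph_le θ x)
  have hi : ∀ θ : Sph k, Integrable fun t => (t - transportMap σ μ ν θ t) *
      gaussianPDFReal 0 (sigmaSq σ) (t - inner ℝ (θ : Euc k) x) := fun θ => by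
    have := hT θ
    exact (integrable_gaussMajorant hv K ‖x‖).mono' (by fun_prop) (ae_of_all _ (hbd θ))
  rw [integrable_prod_iff' hm]
  refine ⟨ae_of_all _ fun θ => ?_, ?_⟩
  · have := hT θ
    exact integrable_comp_inner hσ (f := fun t => t - transportMap σ μ ν θ t) (by fun_prop) (hi θ)
  · refine Integrable.of_bound (C := ∫ t, gaussMajorant (sigmaSq σ) K ‖x‖ t)
      hm.norm.prod_swap.integral_prod_right' (ae_of_all _ fun θ => ?_)
    have := hT θ
    rw [Real.norm_of_nonneg (integral_nonneg fun z => norm_nonneg _),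
      integral_comp_inner hσ (f := fun t => ‖t - transportMap σ μ ν θ t‖) (by fun_prop)]
    have e : ∀ t, ‖t - transportMap σ μ ν θ t‖ *
        gaussianPDFReal 0 (sigmaSq σ) (t - inner ℝ (θ : Euc k) x) =
        |(t - transportMap σ μ ν θ t) *
          gaussianPDFReal 0 (sigmaSq σ) (t - inner ℝ (θ : Euc k) x)| := fun t => by
      rw [abs_mul, abs_of_nonneg (gaussianPDFReal_nonneg _ _ _), Real.norm_eq_abs]
    simp only [e]
    exact integral_mono (hi θ).abs (integrable_gaussMajorant hv K ‖x‖) (hbd θ)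

/-- Back from the density form to an average of the gap over noise and direction, in which the
adjoint of `sliceLp` can be recognized. -/
theorem gradField_eq (hσ : 0 < σ) (ν μ : P2 k) (x : Euc k) :
    gradField σ ν μ x = ∫ r : Euc k × Sph k, (inner ℝ (r.2 : Euc k) (x + r.1) -
      transportMap σ μ ν r.2 (inner ℝ (r.2 : Euc k) (x + r.1))) • (r.2 : Euc k)
      ∂((gauss k σ).prod (unif k)) := by
  rw [gradField, integral_prod_symm _ (integrable_gradIntegrand hσ ν μ x), integral_prod_symm _
    (integrable_smul_sph (integrable_inner_sub_transportMap hσ ν μ x))]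
  refine integral_congr_ae (ae_of_all _ fun θ => ?_)
  have := (differentiable_transportMap hσ μ ν θ).continuous
  simp only
  rw [integral_smul_const, integral_smul_const,
    integral_comp_inner hσ (f := fun t => t - transportMap σ μ ν θ t) (by fun_prop)]

lemma memLp_gap_assoc (hσ : 0 < σ) (ν : P2 k) (X : Lp (Euc k) 2 P) :
    MemLp (fun q : Ω × (Euc k × Sph k) => gap σ ν X X ((q.1, q.2.1), q.2.2)) 2
      (P.prod ((gauss k σ).prod (unif k))) :=
  (memLp_gap hσ ν X X).comp_measurePreserving
    (measurePreserving_prodAssoc P (gauss k σ) (unif k)).symm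

lemma norm_gradField_sq_le (hσ : 0 < σ) (ν : P2 k) (X : Lp (Euc k) 2 P) {ω : Ω}
    (h : MemLp (fun r : Euc k × Sph k => gap σ ν X X ((ω, r.1), r.2)) 2
      ((gauss k σ).prod (unif k))) :
    ‖gradField σ ν (law P X) (X ω)‖ ^ 2 ≤
      ∫ r : Euc k × Sph k, gap σ ν X X ((ω, r.1), r.2) ^ 2 ∂((gauss k σ).prod (unif k)) := by
  have h1 : ‖gradField σ ν (law P X) (X ω)‖ ≤
      ∫ r : Euc k × Sph k, |gap σ ν X X ((ω, r.1), r.2)| ∂((gauss k σ).prod (unif k)) := by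
    rw [gradField_eq hσ]
    refine (norm_integral_le_integral_norm _).trans_eq ?_
    refine integral_congr_ae (ae_of_all _ fun r => ?_)
    simp only [norm_smul, norm_sph, mul_one, gap_self_apply, Real.norm_eq_abs]
  have h2 := integral_mul_le_sqrt_mul_sqrt h.abs (memLp_const (1 : ℝ))
  simp only [Pi.abs_apply, mul_one, one_pow, sq_abs, integral_const, probReal_univ, one_smul,
    Real.sqrt_one] at h2
  have h3 := pow_le_pow_left₀ (norm_nonneg _) (h1.trans h2) 2
  rwa [Real.sq_sqrt (integral_nonneg fun r => sq_nonneg _)] at h3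

lemma continuous_gradField (hσ : 0 < σ) (ν μ : P2 k) : Continuous (gradField σ ν μ) :=
  continuous_iff_continuousAt.2 fun x => (hasFDerivAt_gradField hσ ν μ x).continuousAt

lemma memLp_gradField (hσ : 0 < σ) (ν : P2 k) (X : Lp (Euc k) 2 P) :
    MemLp (fun ω => gradField σ ν (law P X) (X ω)) 2 P := by
  have hg := memLp_gap_assoc hσ ν X
  have hm : AEStronglyMeasurable (fun ω => gradField σ ν (law P X) (X ω)) P :=
    (continuous_gradField hσ ν _).comp_aestronglyMeasurable (Lp.aestronglyMeasurable X)
  rw [memLp_two_iff_integrable_sq_norm hm]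
  refine hg.integrable_sq.integral_prod_left.mono' (hm.norm.pow 2) ?_
  filter_upwards [hg.integrable_sq.prod_right_ae, hg.aestronglyMeasurable.prodMk_left]
    with ω h1 h2
  rw [Real.norm_of_nonneg (sq_nonneg _)]
  exact norm_gradField_sq_le hσ ν X ((memLp_two_iff_integrable_sq h2).2 h1)

lemma inner_gradField_eq (hσ : 0 < σ) (ν : P2 k) (X : Lp (Euc k) 2 P) (ω : Ω) (h : Euc k) :
    ⟪gradField σ ν (law P X) (X ω), h⟫ = ∫ r : Euc k × Sph k, gap σ ν X X ((ω, r.1), r.2) *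
      inner ℝ (r.2 : Euc k) h ∂((gauss k σ).prod (unif k)) := by
  rw [gradField_eq hσ, real_inner_comm, ← integral_inner
    (integrable_smul_sph (integrable_inner_sub_transportMap hσ ν (law P X) (X ω)))]
  refine integral_congr_ae (ae_of_all _ fun r => ?_)
  simp only [gap_self_apply]
  rw [real_inner_smul_right, real_inner_comm h]

/-- Integrating out noise and direction for fixed `ω` computes the adjoint of `sliceLp` at the gap;
this is the gradient. -/
lemma inner_gapLp_sliceLp (hσ : 0 < σ) (ν : P2 k) (X H : Lp (Euc k) 2 P) :
    ⟪gapLp hσ ν X X, sliceLp σ H⟫ = ⟪(memLp_gradField hσ ν X).toLp _, H⟫ := by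
  have hg := memLp_gap hσ ν X X
  have hs := memLp_inner_Lp σ H
  have hi : Integrable (fun q : (Ω × Euc k) × Sph k => gap σ ν X X q *
      inner ℝ (q.2 : Euc k) (H q.1.1)) ((P.prod (gauss k σ)).prod (unif k)) :=
    MemLp.integrable_mul hg hs
  have hL : ⟪gapLp hσ ν X X, sliceLp σ H⟫ = ∫ q, gap σ ν X X q * inner ℝ (q.2 : Euc k) (H q.1.1)
      ∂((P.prod (gauss k σ)).prod (unif k)) := by
    rw [L2.inner_def]
    refine integral_congr_ae ?_
    filter_upwards [hg.coeFn_toLp, hs.coeFn_toLp] with q h1 h2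
    rw [gapLp, sliceLp, h1, h2]
    exact mul_comm _ _
  have hR : ⟪(memLp_gradField hσ ν X).toLp _, H⟫ =
      ∫ ω, ⟪gradField σ ν (law P X) (X ω), H ω⟫ ∂P := by
    rw [L2.inner_def]
    refine integral_congr_ae ?_
    filter_upwards [(memLp_gradField hσ ν X).coeFn_toLp] with ω hω
    rw [hω]
  rw [hL, hR, integral_prod_of_integrable_assoc P (gauss k σ) (unif k) hi]
  exact integral_congr_ae (ae_of_all _ fun ω => (inner_gradField_eq hσ ν X ω (H ω)).symm)

theorem isLDerivative_gradField (hσ : 0 < σ) (ν : P2 k) :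
    IsLDerivative P (fun μ => SW2regSq σ μ ν) (gradField σ ν) := by
  refine ⟨jointlyContinuous_gradField hσ ν, fun X => ⟨memLp_gradField hσ ν X, ?_⟩⟩
  have hnorm : ∀ X Y : Lp (Euc k) 2 P, ‖gapLp hσ ν X Y‖ ^ 2 =
      ∫ q, gap σ ν X Y q ^ 2 ∂((P.prod (gauss k σ)).prod (unif k)) := fun X Y =>
    norm_sq_toLp _
  refine hasGradientAt_of_half_norm_sq (A := fun Y => gapLp hσ ν Y Y) (S := sliceLp σ)
    (continuousAt_gapLp hσ ν X) norm_sliceLp_le (fun Y => ?_) (fun Y Z => ?_)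
    (inner_gapLp_sliceLp hσ ν X)
  · rw [hnorm]
    exact SW2regSq_law_eq hσ ν Y
  · rw [← gapLp_eq_add, hnorm]
    exact SW2regSq_law_le hσ ν Y Z

end LDerivative

end SlicedW

theorem lemma3 (k : ℕ) (hk : 1 ≤ k) :
    ∃ C : ℝ, 0 < C ∧ ∀ (σ : ℝ), 0 < σ → ∀ ν : P2 k,
      ∃ D : P2 k → Euc k → Euc k,
        (∀ (Ω : Type*) [MeasurableSpace Ω] (P : Measure Ω) [IsProbabilityMeasure P],
          IsAtomless P → IsLDerivative P (fun μ => SW2regSq σ μ ν) D) ∧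
        ∀ μ : P2 k,
          (∀ θ : Sph k, Differentiable ℝ (transportMap σ μ ν θ)) ∧
          (∀ x : Euc k,
            Integrable (fun p : Euc k × Sph k => hessIntegrand σ μ ν x p.1 p.2)
              ((gauss k σ).prod (unif k)) ∧
            HasFDerivAt (D μ) (∫ z, ∫ θ, hessIntegrand σ μ ν x z θ ∂(unif k) ∂(gauss k σ)) x) ∧
          Integrable (fun x => ‖fderiv ℝ (D μ) x‖) μ.1 ∧
          ∫ x, ‖fderiv ℝ (D μ) x‖ ∂μ.1 ≤
            C * (1 + 1 / σ * Real.sqrt (∫ y, ‖y‖ ^ 2 ∂(reg σ ν.1))) := by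
  have : NeZero k := ⟨by omega⟩
  -- The constant `1` works in every dimension, as `θθᵀ` has operator norm `1` and `unif k` has
  -- total mass `1`.
  refine ⟨1, one_pos, fun σ hσ ν => ⟨gradField σ ν, fun Ω _ P _ _ => isLDerivative_gradField hσ ν,
    fun μ => ⟨differentiable_transportMap hσ μ ν, fun x => ⟨integrable_hessIntegrand hσ μ ν x,
      hasFDerivAt_gradField_hess hσ ν μ x⟩, ?_⟩⟩⟩
  rw [one_mul]
  exact integral_norm_fderiv_gradField_le hσ μ ν
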